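/- A rooted tree is a finite tree with a distinguished vertex (the root), considered up to isomorphism, and its degree is its number of vertices. For a field $K\supseteq\mathbb{Q}$ let $\mathrm{PL}_n$ be the $K$-vector space with basis the rooted trees of degree $n$, and $\widehat{\mathrm{PL}}_K=\prod_{n\ge 1}\mathrm{PL}_n$. The bilinear product $T\curvearrowleft T'$ of two rooted trees is the sum, over all vertices $v$ of $T$, of the trees obtained from the disjoint union of $T$ and $T'$ by adding an edge from the root of $T'$ to $v$ (the root being that of $T$); it extends to $\widehat{\mathrm{PL}}_K$ (the completed free pre-Lie algebra on one generator). For a power series $f(x)=\sum_{k\ge0} f_k x^k$ and $X,Y\in\widehat{\mathrm{PL}}_K$ write $$X\curvearrowleft f(Y)=\sum_{k\ge 0} f_k\,\bigl((X\curvearrowleft Y)\curvearrowleft\cdots\bigr)\curvearrowleft Y\qquad(k\text{ factors }Y).$$ Let $\bullet$ be the tree with one vertex. Let $\Omega\in\widehat{\mathrm{PL}}_{\mathbb{Q}}$ be the unique solution of $$\bullet\curvearrowleft\frac{\Omega}{\exp(\Omega)-1}=\Omega ,$$ and let $\Omega_q=\sum_{n\ge1}\Omega_{q,n}\in\widehat{\mathrm{PL}}_{\mathbb{Q}(q)}$,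 with $\Omega_{q,n}$ homogeneous of degree $n$, be the unique solution of $$\Omega_q[q]\curvearrowleft(\exp(\Omega)-1)+\Omega_q[q]-\Omega_q=\bullet\curvearrowleft\Omega_q+(q-1)\,\bullet ,$$ where $A[q]=\sum_{n\ge1}q^nA_n$ for $A=\sum_{n\ge 1} A_n$. **Proposition.** For every $n\geq 1$, the (least) common denominator in $\mathbb{Q}[q]$ of the coefficients of $\Omega_{q,n}$ on the rooted trees divides $\prod_{d=2}^{n}\Phi_d$ in $\mathbb{Q}[q]$, where $\Phi_d$ is the $d$-th cyclotomic polynomial. Consequently, every pole in $\mathbb{C}$ of a coefficient of $\Omega_q$ is simple and is located at a root of unity different from $1$. -/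

import Mathlib

namespace RootedTrees

open Polynomial

/-- Planar rooted trees: a root together with the list of the subtrees attached to it. -/
inductive PlanarTree : Type
  | node (children : List PlanarTree) : PlanarTree

namespace PlanarTree

/-- Isomorphism of the underlying (non-planar) rooted trees: the equivalence relation generated by
permuting the subtrees at a vertex. -/
inductive Iso : PlanarTree → PlanarTree → Prop
  | refl (t : PlanarTree) : Iso t t
  | symm {t u : PlanarTree} : Iso t u → Iso u t
  | trans {t u v : PlanarTree} : Iso t u → Iso u v → Iso t v
  | perm {l l' : List PlanarTree} : l.Perm l' → Iso (node l) (node l')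
  | child {t t' : PlanarTree} (l : List PlanarTree) :
      Iso t t' → Iso (node (t :: l)) (node (t' :: l))

instance isoSetoid : Setoid PlanarTree where
  r := Iso
  iseqv := ⟨Iso.refl, Iso.symm, Iso.trans⟩

mutual
  /-- Number of vertices. -/
  def numVertices : PlanarTree → ℕ
    | node l => 1 + numVerticesForest l
  /-- Number of vertices of a forest. -/
  def numVerticesForest : List PlanarTree → ℕ
    | [] => 0
    | t :: l => numVertices t + numVerticesForest l
end

mutual
  /-- The list, indexed by the vertices `v` of the second tree, of the trees obtained by adding an
  edge from the root of `s` to `v`. -/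
  def graftings (s : PlanarTree) : PlanarTree → List PlanarTree
    | node l => node (s :: l) :: (graftingsForest s l).map node
  /-- The same for the vertices of a forest. -/
  def graftingsForest (s : PlanarTree) : List PlanarTree → List (List PlanarTree)
    | [] => []
    | t :: l => (graftings s t).map (fun t' => t' :: l) ++
        (graftingsForest s l).map (fun l' => t :: l')
end

end PlanarTree

/-- Rooted trees, up to isomorphism. -/
def RootedTree : Type := Quotient PlanarTree.isoSetoid

namespace PlanarTree

/-- The isomorphism class of a planar tree. -/
def toRooted (t : PlanarTree) : RootedTree := Quotient.mk isoSetoid t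

/-- The multiset of isomorphism classes of the trees of a forest. -/
def toForest (l : List PlanarTree) : Multiset RootedTree := (l.map toRooted : List RootedTree)

theorem toRooted_eq {t u : PlanarTree} (h : Iso t u) : toRooted t = toRooted u :=
  Quotient.sound h

theorem numVerticesForest_perm {l l' : List PlanarTree} (h : l.Perm l') :
    numVerticesForest l = numVerticesForest l' := by
  induction h with
  | nil => rfl
  | cons a _ ih => simp [numVerticesForest, ih]
  | swap a b l => simp only [numVerticesForest]; omega
  | trans _ _ h1 h2 => exact h1.trans h2

theorem numVertices_iso {t u : PlanarTree} (h : Iso t u) : numVertices t = numVertices u := by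
  induction h with
  | refl t => rfl
  | symm _ ih => exact ih.symm
  | trans _ _ h1 h2 => exact h1.trans h2
  | perm h => simp [numVertices, numVerticesForest_perm h]
  | child l _ ih => simp [numVertices, numVerticesForest, ih]

theorem iso_node_append {l l' : List PlanarTree} (h : List.Forall₂ Iso l l') :
    ∀ r : List PlanarTree, Iso (node (l ++ r)) (node (l' ++ r)) := by
  induction h with
  | nil => intro r; exact Iso.refl _
  | @cons a b l l' hab _ ih =>
    intro r
    refine (Iso.child (l ++ r) hab).trans ?_
    refine (Iso.perm (l' := l ++ (b :: r)) List.perm_middle.symm).trans ?_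
    exact (ih (b :: r)).trans (Iso.perm List.perm_middle)

theorem graftingsForest_numVertices (s : PlanarTree) : ∀ l : List PlanarTree,
    ∀ f ∈ graftingsForest s l, numVerticesForest f = numVerticesForest l + numVertices s
  | [] => by simp [graftingsForest]
  | node c :: l => by
    intro f hf
    simp only [graftingsForest, graftings, List.mem_append, List.mem_map, List.mem_cons] at hf
    rcases hf with ⟨t', h | ⟨f', hf', rfl⟩, rfl⟩ | ⟨l', hl', rfl⟩
    · subst h
      simp only [numVerticesForest, numVertices]; omega
    · have := graftingsForest_numVertices s c f' hf'
      simp only [numVerticesForest, numVertices]; omega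
    · have := graftingsForest_numVertices s l l' hl'
      simp only [numVerticesForest]; omega

theorem graftings_numVertices (s t : PlanarTree) :
    ∀ u ∈ graftings s t, numVertices u = numVertices t + numVertices s := by
  have h := graftingsForest_numVertices s [t]
  intro u hu
  have := h [u] (by simpa [graftingsForest] using hu)
  simpa [numVerticesForest] using this

/-- The isomorphism classes of the trees `graftings s t`, with multiplicities. -/
def graftClasses (s t : PlanarTree) : Multiset RootedTree :=
  ((graftings s t).map toRooted : List RootedTree)

/-- The isomorphism classes of the forests `graftingsForest s l`, with multiplicities. -/
def graftForestClasses (s : PlanarTree) (l : List PlanarTree) : Multiset (Multiset RootedTree) :=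
  ((graftingsForest s l).map toForest : List (Multiset RootedTree))

theorem toForest_cons (t : PlanarTree) (l : List PlanarTree) :
    toForest (t :: l) = toRooted t ::ₘ toForest l := rfl

theorem toForest_perm {l l' : List PlanarTree} (h : l.Perm l') : toForest l = toForest l' :=
  Multiset.coe_eq_coe.mpr (h.map _)

theorem exists_node_class : ∃ b : Multiset RootedTree → RootedTree,
    ∀ l : List PlanarTree, b (toForest l) = toRooted (node l) := by
  refine ⟨fun m => Quotient.liftOn m (fun l => toRooted (node (l.map Quotient.out))) ?_, ?_⟩
  · intro l l' h
    exact toRooted_eq (Iso.perm (List.Perm.map _ h))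
  · intro l
    change toRooted (node ((l.map toRooted).map Quotient.out)) = toRooted (node l)
    have h : List.Forall₂ Iso ((l.map toRooted).map Quotient.out) l := by
      induction l with
      | nil => exact List.Forall₂.nil
      | cons a l ih =>
        have ha : Iso (Quotient.out (toRooted a)) a :=
          Quotient.exact (s := isoSetoid) (Quotient.out_eq (toRooted a))
        exact List.Forall₂.cons ha ih
    simpa using toRooted_eq (iso_node_append h [])

theorem graftForestClasses_cons (s t : PlanarTree) (l : List PlanarTree) :
    graftForestClasses s (t :: l) =
      (graftClasses s t).map (fun x => x ::ₘ toForest l) +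
        (graftForestClasses s l).map (fun f => toRooted t ::ₘ f) := by
  simp only [graftForestClasses, graftClasses, graftingsForest, List.map_append, List.map_map,
    Multiset.map_coe, Multiset.coe_add]
  rfl

theorem graftForestClasses_perm (s : PlanarTree) {l l' : List PlanarTree} (h : l.Perm l') :
    graftForestClasses s l = graftForestClasses s l' := by
  induction h with
  | nil => rfl
  | cons a h ih => rw [graftForestClasses_cons, graftForestClasses_cons, ih, toForest_perm h]
  | swap a b l =>
    simp only [graftForestClasses_cons, Multiset.map_add, Multiset.map_map, Function.comp_def,
      toForest_cons]
    rw [← add_assoc, ← add_assoc]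
    congr 1
    · rw [add_comm]
      congr 1 <;> exact Multiset.map_congr rfl fun x _ => Multiset.cons_swap _ _ _
    · exact Multiset.map_congr rfl fun x _ => Multiset.cons_swap _ _ _
  | trans _ _ h1 h2 => exact h1.trans h2

theorem graftClasses_node (b : Multiset RootedTree → RootedTree)
    (hb : ∀ l, b (toForest l) = toRooted (node l)) (s : PlanarTree) (l : List PlanarTree) :
    graftClasses s (node l) =
      b (toRooted s ::ₘ toForest l) ::ₘ (graftForestClasses s l).map b := by
  simp only [graftClasses, graftForestClasses, graftings, List.map_cons, List.map_map,
    Multiset.map_coe, ← toForest_cons, hb, Function.comp_def, Multiset.cons_coe]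

theorem graftClasses_iso_right (s : PlanarTree) {t u : PlanarTree} (h : Iso t u) :
    graftClasses s t = graftClasses s u := by
  obtain ⟨b, hb⟩ := exists_node_class
  induction h with
  | refl t => rfl
  | symm _ ih => exact ih.symm
  | trans _ _ h1 h2 => exact h1.trans h2
  | perm h =>
    rw [graftClasses_node b hb, graftClasses_node b hb, graftForestClasses_perm s h,
      toForest_perm h]
  | child l h ih =>
    rw [graftClasses_node b hb, graftClasses_node b hb, graftForestClasses_cons,
      graftForestClasses_cons, ih, toForest_cons, toForest_cons, toRooted_eq h]

theorem graftForestClasses_iso_left {s s' : PlanarTree} (h : Iso s s') :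
    ∀ l : List PlanarTree, graftForestClasses s l = graftForestClasses s' l
  | [] => rfl
  | node c :: l => by
    obtain ⟨b, hb⟩ := exists_node_class
    rw [graftForestClasses_cons, graftForestClasses_cons, graftClasses_node b hb,
      graftClasses_node b hb, graftForestClasses_iso_left h c, graftForestClasses_iso_left h l,
      toRooted_eq h]

theorem graftClasses_iso {s s' t t' : PlanarTree} (hs : Iso s s') (ht : Iso t t') :
    graftClasses s t = graftClasses s' t' := by
  rw [graftClasses_iso_right s ht]
  obtain ⟨b, hb⟩ := exists_node_class
  cases t' with
  | node l =>
    rw [graftClasses_node b hb, graftClasses_node b hb, graftForestClasses_iso_left hs,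
      toRooted_eq hs]

end PlanarTree

namespace RootedTree

/-- The rooted tree with one vertex. -/
def dot : RootedTree := PlanarTree.toRooted (PlanarTree.node [])

/-- The degree of a rooted tree, i.e. its number of vertices. -/
def degree : RootedTree → ℕ :=
  Quotient.lift PlanarTree.numVertices fun _ _ h => PlanarTree.numVertices_iso h

/-- The multiset, indexed by the vertices `v` of `T`, of the rooted trees obtained from the
disjoint union of `T` and `T'` by adding an edge from the root of `T'` to `v`. -/
def graft : RootedTree → RootedTree → Multiset RootedTree :=
  Quotient.lift₂ (fun t t' => PlanarTree.graftClasses t' t)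
    fun _ _ _ _ h h' => PlanarTree.graftClasses_iso h' h

theorem degree_pos (T : RootedTree) : 0 < T.degree := by
  induction T using Quotient.inductionOn with
  | h t =>
    cases t with
    | node l =>
      change 0 < PlanarTree.numVertices _
      simp only [PlanarTree.numVertices]; omega

theorem degree_graft (T T' : RootedTree) : ∀ U ∈ graft T T', U.degree = T.degree + T'.degree := by
  induction T using Quotient.inductionOn with
  | h t =>
    induction T' using Quotient.inductionOn with
    | h t' =>
      intro U hU
      change U ∈ PlanarTree.graftClasses t' t at hU
      simp only [PlanarTree.graftClasses, Multiset.mem_coe, List.mem_map] at hU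
      obtain ⟨u, hu, rfl⟩ := hU
      exact PlanarTree.graftings_numVertices t' t u hu

end RootedTree

noncomputable section

/-- The vector space spanned by rooted trees: the free pre-Lie algebra on one generator. -/
abbrev PL (K : Type) [Field K] : Type := RootedTree →₀ K

/-- The pre-Lie product of `PL K`: on basis elements it is the sum of all graftings. -/
def preLie (K : Type) [Field K] : PL K →ₗ[K] PL K →ₗ[K] PL K :=
  Finsupp.linearCombination K fun T =>
    Finsupp.linearCombination K fun T' =>
      ((RootedTree.graft T T').map fun U => (Finsupp.single U 1 : PL K)).sum

/-- The homogeneous component of degree `n` of `PL K`, spanned by the trees with `n` vertices. -/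
def homogeneous (K : Type) [Field K] (n : ℕ) : Submodule K (PL K) :=
  Finsupp.supported K K {T | T.degree = n}

/-- The completion of `PL K`: the product of its homogeneous components (the component of degree
`0` is zero). -/
abbrev CPL (K : Type) [Field K] : Type := ∀ n : ℕ, homogeneous K n

section

variable {K : Type} [Field K]

theorem preLie_mem {i j : ℕ} {A B : PL K} (hA : A ∈ homogeneous K i) (hB : B ∈ homogeneous K j) :
    preLie K A B ∈ homogeneous K (i + j) := by
  rw [preLie, Finsupp.linearCombination_apply, Finsupp.sum, LinearMap.sum_apply]
  refine Submodule.sum_mem _ fun T hT => ?_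
  rw [LinearMap.smul_apply, Finsupp.linearCombination_apply, Finsupp.sum]
  refine Submodule.smul_mem _ _ (Submodule.sum_mem _ fun T' hT' => Submodule.smul_mem _ _ ?_)
  refine multiset_sum_mem _ fun x hx => ?_
  obtain ⟨U, hU, rfl⟩ := Multiset.mem_map.mp hx
  refine Finsupp.single_mem_supported K _ ?_
  have h1 : T.degree = i := hA hT
  have h2 : T'.degree = j := hB hT'
  rw [Set.mem_ofPred_eq, RootedTree.degree_graft T T' U hU, h1, h2]

/-- The pre-Lie product of the completion. -/
def cgraft (A B : CPL K) : CPL K := fun n =>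
  ⟨∑ p ∈ Finset.HasAntidiagonal.antidiagonal n, preLie K (A p.1) (B p.2), Submodule.sum_mem _ fun p hp => by
    rw [← Finset.HasAntidiagonal.mem_antidiagonal.mp hp]
    exact preLie_mem (A p.1).2 (B p.2).2⟩

/-- The one-vertex tree, as an element of the completion. -/
def cdot (K : Type) [Field K] : CPL K :=
  Pi.single 1 ⟨Finsupp.single RootedTree.dot 1, Finsupp.single_mem_supported K _ rfl⟩

/-- The right action of the element `f(Y) = ∑ₖ fₖ Y^{⋆k}` of the completed enveloping algebra,
where `f = ∑ₖ fₖ xᵏ` is a formal power series and `Y` is in the completion: it maps `X` to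
`∑ₖ fₖ ((X ↶ Y) ↶ ⋯) ↶ Y` with `k` factors `Y`. The terms with `k ≥ n` do not contribute
to the degree `n` (see `iterate_cgraft_eq_zero`). -/
def actSeries (f : PowerSeries K) (Y X : CPL K) : CPL K := fun n =>
  ∑ k ∈ Finset.range n, PowerSeries.coeff k f • ((fun Z => cgraft Z Y)^[k] X) n

/-- The `q`-shift: multiplication by `qⁿ` in degree `n`. -/
def shift (q : K) (A : CPL K) : CPL K := fun n => q ^ n • A n

theorem CPL.zero_eq (A : CPL K) : A 0 = 0 := by
  refine Subtype.ext (Finsupp.ext fun T => ?_)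
  by_contra h
  have h1 : T.degree = 0 := (A 0).2 (Finsupp.mem_support_iff.mpr h)
  exact absurd h1 T.degree_pos.ne'

theorem cgraft_congr {n : ℕ} {A A' B B' : CPL K} (hA : ∀ m < n, A m = A' m)
    (hB : ∀ m < n, B m = B' m) : cgraft A B n = cgraft A' B' n := by
  refine Subtype.ext ?_
  simp only [cgraft]
  refine Finset.sum_congr rfl fun p hp => ?_
  have hp' := Finset.HasAntidiagonal.mem_antidiagonal.mp hp
  rcases Nat.eq_zero_or_pos p.1 with h1 | h1
  · rw [h1, CPL.zero_eq A, CPL.zero_eq A']; simp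
  rcases Nat.eq_zero_or_pos p.2 with h2 | h2
  · rw [h2, CPL.zero_eq B, CPL.zero_eq B']; simp
  rw [hA p.1 (by omega), hB p.2 (by omega)]

theorem iterate_cgraft_eq_zero (X Y : CPL K) (k : ℕ) :
    ∀ n ≤ k, ((fun Z => cgraft Z Y)^[k] X) n = 0 := by
  induction k with
  | zero => intro n hn; obtain rfl : n = 0 := by omega
            exact CPL.zero_eq X
  | succ k ih =>
    intro n hn
    rw [Function.iterate_succ_apply']
    have h : cgraft ((fun Z => cgraft Z Y)^[k] X) Y n = cgraft 0 Y n :=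
      cgraft_congr (fun m hm => by rw [ih m (by omega)]; rfl) fun _ _ => rfl
    refine h.trans (Subtype.ext ?_)
    simp [cgraft]

theorem actSeries_congr_left {n : ℕ} (f : PowerSeries K) {Y Y' : CPL K} (X : CPL K)
    (hY : ∀ m < n, Y m = Y' m) : actSeries f Y X n = actSeries f Y' X n := by
  have h : ∀ k, ∀ m ≤ n,
      ((fun Z => cgraft Z Y)^[k] X) m = ((fun Z => cgraft Z Y')^[k] X) m := by
    intro k
    induction k with
    | zero => intro m _; rfl
    | succ k ih =>
      intro m hm
      rw [Function.iterate_succ_apply', Function.iterate_succ_apply']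
      exact cgraft_congr (fun j hj => ih j (by omega)) fun j hj => hY j (by omega)
  exact Finset.sum_congr rfl fun k _ => by rw [h k n le_rfl]

theorem actSeries_congr_right {n : ℕ} {f : PowerSeries K} (hf : PowerSeries.coeff 0 f = 0)
    (Y : CPL K) {X X' : CPL K} (hX : ∀ m < n, X m = X' m) :
    actSeries f Y X n = actSeries f Y X' n := by
  have h : ∀ k, ∀ m < n,
      ((fun Z => cgraft Z Y)^[k] X) m = ((fun Z => cgraft Z Y)^[k] X') m := by
    intro k
    induction k with
    | zero => exact hX
    | succ k ih =>
      intro m hm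
      rw [Function.iterate_succ_apply', Function.iterate_succ_apply']
      exact cgraft_congr (fun j hj => ih j (by omega)) fun _ _ => rfl
  refine Finset.sum_congr rfl fun k _ => ?_
  cases k with
  | zero => rw [hf, zero_smul, zero_smul]
  | succ k =>
    rw [Function.iterate_succ_apply', Function.iterate_succ_apply']
    congr 1
    exact cgraft_congr (h k) fun _ _ => rfl

end

theorem existsUnique_fixedPoint {V : ℕ → Type} [∀ n, Zero (V n)]
    (F : (∀ n, V n) → ∀ n, V n)
    (hF : ∀ n A B, (∀ m < n, A m = B m) → F A n = F B n) : ∃! A, F A = A := by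
  have hstep : ∀ N m, m < N → F^[N] 0 m = F^[N + 1] 0 m := by
    intro N
    induction N with
    | zero => intro m hm; omega
    | succ N ih =>
      intro m hm
      rw [Function.iterate_succ_apply', Function.iterate_succ_apply' F (N + 1)]
      exact hF m _ _ fun j hj => ih j (by omega)
  have hstab : ∀ N m, m < N → F^[m + 1] 0 m = F^[N] 0 m := by
    intro N
    induction N with
    | zero => intro m hm; omega
    | succ N ih =>
      intro m hm
      rcases Nat.lt_or_ge m N with h | h
      · rw [ih m h, hstep N m h]
      · obtain rfl : m = N := by omega
        rfl
  refine ⟨fun m => F^[m + 1] 0 m, ?_, ?_⟩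
  · funext n
    rw [Function.iterate_succ_apply']
    exact hF n _ _ fun m hm => hstab n m hm
  · intro B hB
    funext n
    induction n using Nat.strong_induction_on with
    | _ n ih =>
      rw [← hB]
      rw [Function.iterate_succ_apply']
      exact hF n _ _ fun m hm => (ih m hm).trans (hstab n m hm)

/-- The equation `• ↶ (Ω / (exp Ω - 1)) = Ω`; recall that `bernoulliPowerSeries ℚ` is the power
series `∑ₖ Bₖ xᵏ / k! = x / (exp x - 1)`. -/
def IsOmega (A : CPL ℚ) : Prop :=
  actSeries (bernoulliPowerSeries ℚ) A (cdot ℚ) = A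

theorem existsUnique_isOmega : ∃! A : CPL ℚ, IsOmega A :=
  existsUnique_fixedPoint (fun A => actSeries (bernoulliPowerSeries ℚ) A (cdot ℚ))
    fun _ _ _ h => actSeries_congr_left _ _ h

/-- The classical series `Ω`. -/
def Omega : CPL ℚ := existsUnique_isOmega.choose

theorem isOmega_Omega : IsOmega Omega := existsUnique_isOmega.choose_spec.1

/-- Extension of scalars from `ℚ` to `ℚ(q)`. -/
def extendScalars (A : CPL ℚ) : CPL (RatFunc ℚ) := fun n =>
  ⟨(A n : PL ℚ).mapRange (algebraMap ℚ (RatFunc ℚ)) (map_zero _), fun _ hT =>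
    (A n).2 (Finsupp.support_mapRange hT)⟩

/-- The equation `Ω_q[q] ↶ (exp Ω - 1) + Ω_q[q] - Ω_q = • ↶ Ω_q + (q - 1) •`, where `A[q]` is the
`q`-shift of `A`. -/
def IsOmegaQ (A : CPL (RatFunc ℚ)) : Prop :=
  actSeries (PowerSeries.exp (RatFunc ℚ) - 1) (extendScalars Omega) (shift RatFunc.X A)
      + shift RatFunc.X A - A =
    cgraft (cdot (RatFunc ℚ)) A + (RatFunc.X - 1 : RatFunc ℚ) • cdot (RatFunc ℚ)

theorem X_pow_sub_one_ne_zero {n : ℕ} (hn : 0 < n) : (RatFunc.X ^ n - 1 : RatFunc ℚ) ≠ 0 := by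
  intro h
  have h1 : algebraMap ℚ[X] (RatFunc ℚ) (X ^ n - 1) = 0 := by simpa using h
  replace h1 := (map_eq_zero_iff _ (RatFunc.algebraMap_injective ℚ)).mp h1
  exact (Polynomial.monic_X_pow_sub_C (1 : ℚ) hn.ne').ne_zero (by simpa using h1)

theorem existsUnique_isOmegaQ : ∃! A : CPL (RatFunc ℚ), IsOmegaQ A := by
  set q : RatFunc ℚ := RatFunc.X with hq
  set f : PowerSeries (RatFunc ℚ) := PowerSeries.exp (RatFunc ℚ) - 1 with hf
  have hf0 : PowerSeries.coeff 0 f = 0 := by simp [hf]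
  let F : CPL (RatFunc ℚ) → CPL (RatFunc ℚ) := fun A n =>
    (q ^ n - 1)⁻¹ • ((cgraft (cdot (RatFunc ℚ)) A + (q - 1) • cdot (RatFunc ℚ)) n
      - actSeries f (extendScalars Omega) (shift q A) n)
  have key : ∀ A, IsOmegaQ A ↔ F A = A := by
    intro A
    rw [IsOmegaQ, funext_iff, funext_iff]
    refine forall_congr' fun n => ?_
    rcases Nat.eq_zero_or_pos n with rfl | hn
    · exact iff_of_true ((CPL.zero_eq _).trans (CPL.zero_eq _).symm)
        ((CPL.zero_eq _).trans (CPL.zero_eq _).symm)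
    · have h0 := X_pow_sub_one_ne_zero hn
      change _ ↔ (q ^ n - 1)⁻¹ • _ = A n
      rw [inv_smul_eq_iff₀ h0, sub_smul, one_smul, sub_eq_iff_eq_add]
      change actSeries f (extendScalars Omega) (shift q A) n + q ^ n • A n - A n = _ ↔ _
      rw [eq_comm]
      constructor
      · intro h; rw [h]; abel
      · intro h; rw [h]; abel
  have hF : ∃! A, F A = A := by
    refine existsUnique_fixedPoint F fun n A B h => ?_
    have h1 : cgraft (cdot (RatFunc ℚ)) A n = cgraft (cdot (RatFunc ℚ)) B n :=
      cgraft_congr (fun _ _ => rfl) h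
    have h2 : actSeries f (extendScalars Omega) (shift q A) n =
        actSeries f (extendScalars Omega) (shift q B) n :=
      actSeries_congr_right hf0 _ fun m hm => by simp only [shift, h m hm]
    simp only [F, Pi.add_apply, h1, h2]
  simpa only [key] using hF

/-- The series `Ω_q`. -/
def OmegaQ : CPL (RatFunc ℚ) := existsUnique_isOmegaQ.choose

theorem isOmegaQ_OmegaQ : IsOmegaQ OmegaQ := existsUnique_isOmegaQ.choose_spec.1

/-- The ideal of the polynomials `p ∈ ℚ[q]` such that all the coefficients of `p • A` are
polynomials. -/
def denominatorIdeal (A : PL (RatFunc ℚ)) : Ideal ℚ[X] where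
  carrier := {p | ∀ T, ∃ r : ℚ[X], algebraMap ℚ[X] (RatFunc ℚ) p * A T = algebraMap _ _ r}
  zero_mem' := fun _ => ⟨0, by simp⟩
  add_mem' := fun {a b} ha hb T => by
    obtain ⟨r, hr⟩ := ha T
    obtain ⟨s, hs⟩ := hb T
    exact ⟨r + s, by rw [map_add, map_add, add_mul, hr, hs]⟩
  smul_mem' := fun c a ha T => by
    obtain ⟨r, hr⟩ := ha T
    exact ⟨c * r, by rw [smul_eq_mul, map_mul, map_mul, mul_assoc, hr]⟩

/-- The (least) common denominator in `ℚ[q]` of the coefficients of `A`, which is well defined up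
to a nonzero rational constant: the generator of the ideal of all common denominators. -/
def commonDenominator (A : PL (RatFunc ℚ)) : ℚ[X] :=
  Submodule.IsPrincipal.generator (denominatorIdeal A)

theorem commonDenominator_dvd_iff (A : PL (RatFunc ℚ)) {p : ℚ[X]} (hp : p ≠ 0) :
    commonDenominator A ∣ p ↔ ∀ T, (A T).denom ∣ p := by
  rw [commonDenominator, ← Submodule.IsPrincipal.mem_iff_generator_dvd]
  refine forall_congr' fun T => ?_
  have hp' : algebraMap ℚ[X] (RatFunc ℚ) p ≠ 0 := RatFunc.algebraMap_ne_zero hp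
  rw [RatFunc.denom_dvd hp]
  exact exists_congr fun r => by rw [eq_div_iff hp', mul_comm]

/-- The order of the pole of the rational function `f` at `z` (zero when `f` has no pole at `z`):
the multiplicity of `z` as a root of the denominator of the reduced fraction `f`. -/
def poleOrder (f : RatFunc ℚ) (z : ℂ) : ℕ :=
  (f.denom.map (algebraMap ℚ ℂ)).rootMultiplicity z

end

end RootedTrees

-- Write d for the one-vertex tree, U for Ω_q, R_B for A ↦ A ↶ B, and E for the operator A ↦ A[q] ↶
-- exp Ω (`shiftExp`). The equation of Ω_q reads EU − U = d ↶ U + (q − 1)d, and inverting x/(exp x −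
-- 1) in the equation of Ω gives d = Ω ↶ (exp Ω − 1)/Ω.
--
-- The key fact is that D = (q − 1)·deg + R_U commutes with E (`commute_degree_add_rightMul`). It
-- comes from conjugating right multiplications and the degree derivation by exp Ω, which rests on
-- the pre-Lie identity (`preLie_identity`); the equations of Ω and Ω_q say exactly that the
-- conjugates match.
--
-- E is triangular for the degree filtration, with the scalar qⁿ in degree n. These scalars are
-- distinct, so an operator that preserves the filtration and commutes with E is determined by its
-- diagonal part (`apply_mem_filt_of_commute`). The diagonal of D is (q − 1)n, so D plays the role
-- of (q − 1) log_q E. Put P_k = ∏_{1≤i≤k} (1 − q⁻ⁱE). The q-Newton expansion of the logarithm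
-- (`sum_prod_one_sub_div`) gives D = (q − 1) − ∑_{k≥0} (q − 1)/(q^{k+1} − 1) P_{k+1}. Applying this
-- to d and cancelling the injective operator E − 1 yields U = ∑_{k≥0} (q − 1)/(q^{k+1} − 1) P_k d
-- (`eq_sum_shiftExpProd`).
--
-- The factors of P_k annihilate the leading terms in degrees 1, …, k successively, so P_k d starts
-- in degree k + 1. Hence only k < n matter in degree n, and each division by q^{k+1} is harmless,
-- so P_k d has polynomial coefficients (`shiftExpProd_mem_polynomialSeries`). The only denominators
-- left are (q^m − 1)/(q − 1) with m ≤ n, which divide the squarefree product of the Φ_d for 2 ≤ d ≤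
-- n.

namespace RootedTrees

open Polynomial
open Finset.HasAntidiagonal (antidiagonal mem_antidiagonal)

noncomputable section

-- The right pre-Lie identity for grafting of rooted trees

section PreLieIdentity

open PlanarTree

/-- The rooted tree obtained by joining the trees of a forest to a new root. -/
def RootedTree.join : Multiset RootedTree → RootedTree := exists_node_class.choose

theorem RootedTree.join_toForest (l : List PlanarTree) :
    RootedTree.join (toForest l) = toRooted (node l) :=
  exists_node_class.choose_spec l

theorem exists_toForest_eq (m : Multiset RootedTree) : ∃ l : List PlanarTree, toForest l = m := by
  induction m using Multiset.induction_on with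
  | empty => exact ⟨[], rfl⟩
  | cons T m ih =>
    obtain ⟨l, rfl⟩ := ih
    induction T using Quotient.inductionOn with
    | h t => exact ⟨t :: l, rfl⟩

variable (K : Type) [Field K]

/-- The algebra of forests, i.e. the polynomial algebra on rooted trees. -/
abbrev ForestAlgebra : Type := MvPolynomial RootedTree K

/-- A forest as an element of the forest algebra. -/
def forestMonomial (m : Multiset RootedTree) : ForestAlgebra K :=
  (m.map (MvPolynomial.X : RootedTree → ForestAlgebra K)).prod

/-- The inclusion of trees into forests. -/
def treeForest : PL K →ₗ[K] ForestAlgebra K :=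
  Finsupp.linearCombination K (MvPolynomial.X : RootedTree → ForestAlgebra K)

/-- The linear extension of `RootedTree.join`. -/
def joinLinear : ForestAlgebra K →ₗ[K] PL K :=
  (MvPolynomial.basisMonomials RootedTree K).constr K fun s =>
    (Finsupp.single (RootedTree.join s.toMultiset) 1 : PL K)

/-- Grafting on the vertices of a forest, a derivation of the forest algebra. -/
def graftDerivation :
    PL K →ₗ[K] Derivation K (ForestAlgebra K) (ForestAlgebra K) :=
  (MvPolynomial.mkDerivationEquiv K).toLinearMap ∘ₗ
    LinearMap.pi fun T => treeForest K ∘ₗ preLie K (Finsupp.single T 1)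

variable {K}

theorem forestMonomial_cons (T : RootedTree) (m : Multiset RootedTree) :
    forestMonomial K (T ::ₘ m) = MvPolynomial.X T * forestMonomial K m := by
  simp [forestMonomial]

theorem forestMonomial_eq_monomial [DecidableEq RootedTree] (m : Multiset RootedTree) :
    forestMonomial K m = MvPolynomial.monomial (Multiset.toFinsupp m) 1 := by
  induction m using Multiset.induction_on with
  | empty => simp [forestMonomial]
  | cons T m ih =>
    rw [forestMonomial_cons, ih, ← Multiset.singleton_add, map_add, Multiset.toFinsupp_singleton,
      MvPolynomial.X, MvPolynomial.monomial_mul, one_mul]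

theorem joinLinear_forestMonomial (m : Multiset RootedTree) :
    joinLinear K (forestMonomial K m) = Finsupp.single (RootedTree.join m) 1 := by
  classical
  have h : (Multiset.toFinsupp m).toMultiset = m := by simp
  have h' : forestMonomial K m =
      MvPolynomial.basisMonomials RootedTree K (Multiset.toFinsupp m) := by
    rw [forestMonomial_eq_monomial, MvPolynomial.coe_basisMonomials]
  rw [h', joinLinear, Module.Basis.constr_basis, h]

theorem treeForest_single (T : RootedTree) :
    treeForest K (Finsupp.single T 1) = MvPolynomial.X T := by
  simp [treeForest]

theorem graftDerivation_X (B : PL K) (T : RootedTree) :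
    graftDerivation K B (MvPolynomial.X T) = treeForest K (preLie K (Finsupp.single T 1) B) :=
  MvPolynomial.mkDerivation_X _ _ _

theorem graftDerivation_treeForest (A B : PL K) :
    graftDerivation K B (treeForest K A) = treeForest K (preLie K A B) := by
  induction A using Finsupp.induction_linear with
  | zero => simp
  | add f g hf hg => simp only [map_add, hf, hg, LinearMap.add_apply]
  | single T c =>
    have h : (Finsupp.single T c : PL K) = c • Finsupp.single T 1 := by simp
    rw [h]
    simp only [map_smul, LinearMap.smul_apply, treeForest_single, graftDerivation_X,
      Derivation.map_smul]

theorem preLie_single (T T' : RootedTree) :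
    preLie K (Finsupp.single T 1) (Finsupp.single T' 1) =
      ((RootedTree.graft T T').map fun U => (Finsupp.single U 1 : PL K)).sum := by
  simp [preLie]

/-- The Leibniz rule mirrors the recursion on forests: the vertex that receives `s` lies either in
the first tree or in the others. -/
theorem graftDerivation_forestMonomial (s : PlanarTree) (l : List PlanarTree) :
    graftDerivation K (Finsupp.single (toRooted s) 1) (forestMonomial K (toForest l)) =
      ((graftForestClasses s l).map (forestMonomial K)).sum := by
  induction l with
  | nil =>
    have h : forestMonomial K (toForest []) = 1 := by simp [forestMonomial, toForest]
    rw [h, Derivation.map_one_eq_zero]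
    rfl
  | cons t l ih =>
    rw [toForest_cons, forestMonomial_cons, Derivation.leibniz, ih, graftForestClasses_cons,
      graftDerivation_X, preLie_single, map_multiset_sum]
    simp only [Multiset.map_add, Multiset.map_map, Multiset.sum_add, Function.comp_def,
      forestMonomial_cons, treeForest_single, smul_eq_mul, Multiset.sum_map_mul_left,
      Multiset.sum_map_mul_right]
    rw [add_comm]
    congr 1
    exact mul_comm _ _

/-- The vertex that receives `B` is either the new root, and then `B` becomes one more branch, or a
vertex of the forest, and then the grafting derivation acts. -/
theorem preLie_joinLinear (G : ForestAlgebra K) (B : PL K) :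
    preLie K (joinLinear K G) B =
      joinLinear K (treeForest K B * G + graftDerivation K B G) := by
  classical
  induction G using MvPolynomial.induction_on' with
  | add p q hp hq =>
    simp only [map_add, LinearMap.add_apply, hp, hq, mul_add]
    abel
  | monomial u a =>
    obtain ⟨l, hl⟩ := exists_toForest_eq u.toMultiset
    have hu : MvPolynomial.monomial u a = a • forestMonomial K (toForest l) := by
      rw [forestMonomial_eq_monomial, hl, Finsupp.toMultiset_toFinsupp, MvPolynomial.smul_monomial,
        smul_eq_mul, mul_one]
    rw [hu]
    simp only [map_smul, LinearMap.smul_apply, Derivation.map_smul, mul_smul_comm, ← smul_add]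
    congr 1
    induction B using Finsupp.induction_linear with
    | zero => simp
    | add f g hf hg =>
      simp only [map_add, hf, hg, add_mul, Derivation.add_apply]
      abel
    | single T c =>
      have h : (Finsupp.single T c : PL K) = c • Finsupp.single T 1 := by simp
      rw [h]
      simp only [map_smul, smul_mul_assoc, Derivation.smul_apply, ← smul_add]
      congr 1
      induction T using Quotient.inductionOn with
      | h s =>
        change preLie K _ (Finsupp.single (toRooted s) 1) =
          joinLinear K (treeForest K (Finsupp.single (toRooted s) 1) * _ +
            graftDerivation K (Finsupp.single (toRooted s) 1) _)
        rw [joinLinear_forestMonomial, preLie_single, graftDerivation_forestMonomial,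
          treeForest_single, ← forestMonomial_cons, map_add, joinLinear_forestMonomial,
          map_multiset_sum, RootedTree.join_toForest]
        change (Multiset.map _ (graftClasses s (node l))).sum = _
        rw [graftClasses_node _ RootedTree.join_toForest]
        simp only [Multiset.map_cons, Multiset.sum_cons, Multiset.map_map, Function.comp_def,
          joinLinear_forestMonomial]

/-- The right pre-Lie identity, for a given first argument. -/
def RightPreLieAt (A : PL K) : Prop :=
  ∀ B C : PL K, preLie K (preLie K A B) C - preLie K (preLie K A C) B =
    preLie K A (preLie K B C - preLie K C B)

/-- A commutator of derivations is a derivation, so it is enough to compare both sides on the trees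
occurring in `G`, where the claim is the pre-Lie identity itself. -/
theorem graftDerivation_commutator (G : ForestAlgebra K)
    (hG : ∀ T ∈ G.vars, RightPreLieAt (Finsupp.single T 1 : PL K)) (B C : PL K) :
    graftDerivation K C (graftDerivation K B G) - graftDerivation K B (graftDerivation K C G) =
      graftDerivation K (preLie K B C - preLie K C B) G := by
  rw [← Derivation.commutator_apply]
  refine MvPolynomial.derivation_eq_of_forall_mem_vars fun T hT => ?_
  rw [Derivation.commutator_apply]
  simp only [graftDerivation_X, graftDerivation_treeForest]
  rw [← map_sub, hG T hT]

/-- The induction step from the branches to the whole tree. On expanding, the terms symmetric in `B`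
and `C` cancel; what remains is the product with the bracket plus the commutator of the two
derivations. -/
theorem rightPreLieAt_joinLinear (G : ForestAlgebra K)
    (hG : ∀ T ∈ G.vars, RightPreLieAt (Finsupp.single T 1 : PL K)) :
    RightPreLieAt (joinLinear K G) := by
  intro B C
  rw [preLie_joinLinear G B, preLie_joinLinear G C, preLie_joinLinear, preLie_joinLinear,
    preLie_joinLinear, ← map_sub, ← graftDerivation_commutator G hG]
  congr 1
  simp only [map_add, map_sub, Derivation.leibniz, graftDerivation_treeForest, smul_eq_mul]
  ring

theorem rightPreLieAt_forest : ∀ l : List PlanarTree, ∀ t ∈ l,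
    RightPreLieAt (Finsupp.single (toRooted t) 1 : PL K)
  | [] => by simp
  | node c :: l => by
    classical
    intro t ht
    rcases List.mem_cons.mp ht with rfl | ht
    · rw [← RootedTree.join_toForest, ← joinLinear_forestMonomial]
      refine rightPreLieAt_joinLinear _ fun T hT => ?_
      rw [forestMonomial_eq_monomial, MvPolynomial.vars_monomial one_ne_zero] at hT
      have hT' : T ∈ toForest c := by simpa using hT
      obtain ⟨t, ht, rfl⟩ := List.mem_map.mp (Multiset.mem_coe.mp hT')
      exact rightPreLieAt_forest c t ht
    · exact rightPreLieAt_forest l t ht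

/-- `PL K` is a right pre-Lie algebra. -/
theorem preLie_identity (A B C : PL K) :
    preLie K (preLie K A B) C - preLie K (preLie K A C) B =
      preLie K A (preLie K B C - preLie K C B) := by
  induction A using Finsupp.induction_linear with
  | zero => simp
  | add f g hf hg =>
    simp only [map_add, LinearMap.add_apply, ← hf, ← hg]
    abel
  | single T c =>
    have h : (Finsupp.single T c : PL K) = c • Finsupp.single T 1 := by simp
    rw [h]
    simp only [map_smul, LinearMap.smul_apply, ← smul_sub]
    congr 1
    induction T using Quotient.inductionOn with
    | h t => exact rightPreLieAt_forest [t] t (List.mem_singleton_self t) B C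

end PreLieIdentity

theorem sum_antidiagonal_assoc {M : Type*} [AddCommMonoid M] (f : ℕ → ℕ → ℕ → M) (n : ℕ) :
    ∑ p ∈ antidiagonal n, ∑ r ∈ antidiagonal p.1, f r.1 r.2 p.2 =
      ∑ p ∈ antidiagonal n, ∑ r ∈ antidiagonal p.2, f p.1 r.1 r.2 := by
  rw [Finset.sum_sigma', Finset.sum_sigma']
  refine Finset.sum_nbij' (fun x => ⟨(x.2.1, x.2.2 + x.1.2), (x.2.2, x.1.2)⟩)
    (fun x => ⟨(x.1.1 + x.2.1, x.2.2), (x.1.1, x.2.1)⟩) ?_ ?_ ?_ ?_ ?_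
  all_goals
    rintro ⟨⟨a, b⟩, ⟨c, d⟩⟩ h
    simp only [Finset.mem_sigma, mem_antidiagonal] at h
    obtain ⟨h1, h2⟩ := h
  · exact Finset.mem_sigma.mpr ⟨mem_antidiagonal.mpr (by simp only; omega),
      mem_antidiagonal.mpr rfl⟩
  · exact Finset.mem_sigma.mpr ⟨mem_antidiagonal.mpr (by simp only; omega),
      mem_antidiagonal.mpr rfl⟩
  · simp [h2]
  · simp [h2]
  · rfl

-- Complete graded pre-Lie algebras and convergent sums

section Graded

/-- The elements all of whose components of degree less than `n` vanish. -/
def filt (K : Type) (V : ℕ → Type) [Field K] [∀ n, AddCommGroup (V n)] [∀ n, Module K (V n)]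
    (n : ℕ) : Submodule K (∀ n, V n) where
  carrier := {A | ∀ m < n, A m = 0}
  zero_mem' := fun _ _ => rfl
  add_mem' := fun {A B} hA hB m hm => by rw [Pi.add_apply, hA m hm, hB m hm, add_zero]
  smul_mem' := fun c A hA m hm => by rw [Pi.smul_apply, hA m hm, smul_zero]

/-- Multiplication by `qⁿ` in degree `n`. -/
def gradedShift {K : Type} (V : ℕ → Type) [Field K] [∀ n, AddCommGroup (V n)]
    [∀ n, Module K (V n)] (q : K) : Module.End K (∀ n, V n) where
  toFun A n := q ^ n • A n
  map_add' A B := by funext n; simp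
  map_smul' c A := by funext n; exact smul_comm _ _ _

/-- Multiplication by `n` in degree `n`. -/
def gradedDegree (K : Type) (V : ℕ → Type) [Field K] [∀ n, AddCommGroup (V n)]
    [∀ n, Module K (V n)] : Module.End K (∀ n, V n) where
  toFun A n := (n : K) • A n
  map_add' A B := by funext n; simp
  map_smul' c A := by funext n; exact smul_comm _ _ _

/-- A complete right pre-Lie algebra graded by the positive integers. -/
structure GradedPreLie (K : Type) (V : ℕ → Type) [Field K] [∀ n, AddCommGroup (V n)]
    [∀ n, Module K (V n)] where
  /-- The product. -/
  mul : (∀ n, V n) →ₗ[K] (∀ n, V n) →ₗ[K] (∀ n, V n)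
  mul_identity : ∀ A B C : ∀ n, V n, mul (mul A B) C - mul (mul A C) B = mul A (mul B C - mul C B)
  mem_filt_one : ∀ A : ∀ n, V n, A ∈ filt K V 1
  mul_mem_filt : ∀ {a b : ℕ} {A B : ∀ n, V n}, A ∈ filt K V a → B ∈ filt K V b → mul A B ∈ filt K V (a + b)
  shift_mul : ∀ (q : K) (A B : ∀ n, V n),
    gradedShift V q (mul A B) = mul (gradedShift V q A) (gradedShift V q B)
  degree_mul : ∀ A B : ∀ n, V n, gradedDegree K V (mul A B) =
    mul (gradedDegree K V A) B + mul A (gradedDegree K V B)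

variable {K : Type} {V : ℕ → Type} [Field K] [∀ n, AddCommGroup (V n)] [∀ n, Module K (V n)]

theorem filt_anti {m n : ℕ} (h : m ≤ n) : filt K V n ≤ filt K V m :=
  fun _ hA j hj => hA j (hj.trans_le h)

theorem mem_filt_zero (A : ∀ n, V n) : A ∈ filt K V 0 := fun m hm => absurd hm m.not_lt_zero

/-- The sum of a sequence whose `n`th term lies in `filt K V n`. -/
def filtSum (a : ℕ → ∀ n, V n) : ∀ n, V n := fun m => ∑ n ∈ Finset.range (m + 1), a n m

theorem filtSum_apply {a : ℕ → ∀ n, V n} (ha : ∀ n, a n ∈ filt K V n) {m N : ℕ} (h : m < N) :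
    filtSum a m = (∑ n ∈ Finset.range N, a n) m := by
  rw [Finset.sum_apply]
  refine Finset.sum_subset (Finset.range_mono h) fun n _ hn => ha n m ?_
  simpa using hn

/-- Preserving the filtration is a form of continuity: in degree `m` only a finite partial sum
matters, and `T` is additive on it. -/
theorem map_filtSum {T : Module.End K (∀ n, V n)} (hT : ∀ n, ∀ A ∈ filt K V n, T A ∈ filt K V n)
    {a : ℕ → ∀ n, V n} (ha : ∀ n, a n ∈ filt K V n) : T (filtSum a) = filtSum fun n => T (a n) := by
  funext m
  have h : T (filtSum a - ∑ n ∈ Finset.range (m + 1), a n) m = 0 := by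
    refine hT (m + 1) _ (fun j hj => ?_) m (Nat.lt_succ_self m)
    change filtSum a j - (∑ n ∈ Finset.range (m + 1), a n) j = 0
    rw [sub_eq_zero, filtSum_apply ha hj]
  rw [map_sub, map_sum] at h
  rw [filtSum_apply (fun n => hT n _ (ha n)) (Nat.lt_succ_self m)]
  exact sub_eq_zero.mp h

theorem filtSum_add (a b : ℕ → ∀ n, V n) :
    filtSum (fun n => a n + b n) = filtSum a + filtSum b := by
  funext m
  simp only [filtSum, Pi.add_apply, Finset.sum_add_distrib]

theorem filtSum_smul (c : K) (a : ℕ → ∀ n, V n) :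
    filtSum (fun n => c • a n) = c • filtSum a := by
  funext m
  simp only [filtSum, Pi.smul_apply, Finset.smul_sum]

theorem filtSum_succ {a : ℕ → ∀ n, V n} (ha : ∀ n, a n ∈ filt K V n) :
    filtSum a = a 0 + filtSum fun n => a (n + 1) := by
  funext m
  rw [Pi.add_apply, filtSum_apply ha (Nat.lt_succ_of_lt (Nat.lt_succ_self m)),
    Finset.sum_range_succ', Pi.add_apply, add_comm, Finset.sum_apply]
  rfl

theorem filtSum_filtSum {a : ℕ → ℕ → ∀ n, V n} (ha : ∀ i k, a i k ∈ filt K V (i + k)) :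
    filtSum (fun i => filtSum (a i)) =
      filtSum fun n => ∑ p ∈ antidiagonal n, a p.1 p.2 := by
  funext m
  simp only [filtSum, Finset.sum_apply]
  rw [← Finset.sum_product', Finset.sum_sigma']
  symm
  refine Finset.sum_bij_ne_zero (fun x _ _ => x.2) ?_ ?_ ?_ ?_
  · rintro ⟨n, i, k⟩ h _
    simp only [Finset.mem_sigma, Finset.mem_range, mem_antidiagonal] at h
    simp only [Finset.mem_product, Finset.mem_range]
    omega
  · rintro ⟨n, i, k⟩ h _ ⟨n', i', k'⟩ h' _ heq
    simp only [Finset.mem_sigma, Finset.mem_range, mem_antidiagonal] at h h' heq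
    obtain ⟨rfl, rfl⟩ := Prod.mk.inj heq
    obtain rfl : n = n' := by omega
    rfl
  · rintro ⟨i, k⟩ _ hne
    have h : i + k ≤ m := by
      by_contra h
      exact hne (ha i k m (by omega))
    exact ⟨⟨i + k, i, k⟩, by simp; omega, hne, rfl⟩
  · rintro ⟨n, i, k⟩ _ _
    rfl

namespace GradedPreLie

variable (G : GradedPreLie K V)

/-- Right multiplication by `B`. -/
def rightMul (B : ∀ n, V n) : Module.End K (∀ n, V n) := G.mul.flip B

theorem rightMul_apply (A B : ∀ n, V n) : G.rightMul B A = G.mul A B := rfl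

/-- The Lie bracket with `Y`. -/
def adjoint (Y : ∀ n, V n) : Module.End K (∀ n, V n) := G.mul Y - G.rightMul Y

theorem mul_eq_adjoint_add (Y B : ∀ n, V n) : G.mul Y B = G.adjoint Y B + G.rightMul Y B :=
  (sub_add_cancel (G.mul Y B) (G.rightMul Y B)).symm

/-- The pre-Lie identity in operator form: the commutator of two right multiplications is the right
multiplication by a bracket. -/
theorem rightMul_mul_rightMul (B Y : ∀ n, V n) :
    G.rightMul B * G.rightMul Y = G.rightMul Y * G.rightMul B + G.rightMul (G.adjoint Y B) :=
  LinearMap.ext fun A => sub_eq_iff_eq_add'.mp (G.mul_identity A Y B)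

theorem rightMul_mem_filt {n : ℕ} {A : ∀ n, V n} (B : ∀ n, V n) (hA : A ∈ filt K V n) :
    G.rightMul B A ∈ filt K V (n + 1) :=
  G.mul_mem_filt hA (G.mem_filt_one B)

theorem adjoint_mem_filt {n : ℕ} {A : ∀ n, V n} (Y : ∀ n, V n) (hA : A ∈ filt K V n) :
    G.adjoint Y A ∈ filt K V (n + 1) :=
  Submodule.sub_mem _ (add_comm 1 n ▸ G.mul_mem_filt (G.mem_filt_one Y) hA)
    (G.rightMul_mem_filt Y hA)

theorem rightMul_pow_mem_filt {n : ℕ} {A : ∀ n, V n} (B : ∀ n, V n) (hA : A ∈ filt K V n)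
    (i : ℕ) : (G.rightMul B ^ i) A ∈ filt K V (i + n) := by
  induction i with
  | zero => simpa using hA
  | succ i ih =>
    rw [pow_succ', Module.End.mul_apply, show i + 1 + n = i + n + 1 by omega]
    exact G.rightMul_mem_filt B ih

end GradedPreLie

end Graded

-- Conjugation by the action of an exponential

section Exponential

theorem sum_antidiagonal_choose_succ_smul {M : Type*} [AddCommMonoid M] (f : ℕ → ℕ → M) (n : ℕ) :
    ∑ p ∈ antidiagonal (n + 1), (n + 1).choose p.1 • f p.1 p.2 =
      ∑ p ∈ antidiagonal n, n.choose p.1 • (f p.1 (p.2 + 1) + f (p.1 + 1) p.2) := by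
  rw [Finset.sum_antidiagonal_choose_succ_nsmul, ← Finset.sum_add_distrib]
  refine Finset.sum_congr rfl fun p hp => ?_
  rw [smul_add, Nat.choose_symm_of_eq_add (mem_antidiagonal.mp hp).symm]

/-- The `x k` are the iterated commutators of `x 0` with `r`, so this is the binomial formula for
moving `x j` through a power of `r`. -/
theorem mul_pow_of_commutator {R : Type*} [Ring R] (r : R) (x : ℕ → R)
    (h : ∀ k, x k * r = r * x k + x (k + 1)) (n j : ℕ) :
    x j * r ^ n = ∑ p ∈ antidiagonal n, n.choose p.1 • (r ^ p.1 * x (j + p.2)) := by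
  induction n generalizing j with
  | zero => simp
  | succ n ih =>
    rw [sum_antidiagonal_choose_succ_smul (fun i k => r ^ i * x (j + k)), pow_succ', ← mul_assoc, h,
      add_mul, mul_assoc, ih, ih, Finset.mul_sum, add_comm, ← Finset.sum_add_distrib]
    refine Finset.sum_congr rfl fun p _ => ?_
    rw [smul_add, mul_smul_comm, ← mul_assoc, ← pow_succ', add_right_comm, add_assoc]

theorem inv_factorial_smul_choose {K M : Type*} [Field K] [CharZero K] [AddCommGroup M] [Module K M]
    (i k : ℕ) (x : M) : ((i + k).factorial : K)⁻¹ • (i + k).choose i • x =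
      (i.factorial : K)⁻¹ • (k.factorial : K)⁻¹ • x := by
  rw [← Nat.cast_smul_eq_nsmul K, smul_smul, smul_smul]
  congr 1
  have h := Nat.add_choose_mul_factorial_mul_factorial i k
  have h1 : ((i + k).factorial : K) ≠ 0 := Nat.cast_ne_zero.mpr (Nat.factorial_ne_zero _)
  have h2 : (i.factorial : K) ≠ 0 := Nat.cast_ne_zero.mpr (Nat.factorial_ne_zero _)
  have h3 : (k.factorial : K) ≠ 0 := Nat.cast_ne_zero.mpr (Nat.factorial_ne_zero _)
  field_simp
  rw [← h, Nat.choose_symm_add]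
  push_cast
  ring

variable {K : Type} {V : ℕ → Type} [Field K] [∀ n, AddCommGroup (V n)] [∀ n, Module K (V n)]

theorem gradedDegree_mem_filt {n : ℕ} {A : ∀ n, V n} (hA : A ∈ filt K V n) :
    gradedDegree K V A ∈ filt K V n := fun m hm => by
  change (m : K) • A m = 0
  rw [hA m hm, smul_zero]

namespace GradedPreLie

variable (G : GradedPreLie K V) (Y : ∀ n, V n)

theorem inv_factorial_smul_pow_mem_filt (A : ∀ n, V n) (n : ℕ) :
    (n.factorial : K)⁻¹ • (G.rightMul Y ^ n) A ∈ filt K V n :=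
  Submodule.smul_mem _ _ (G.rightMul_pow_mem_filt Y (mem_filt_zero A) n)

/-- The right action of `exp Y`. -/
def expMul : Module.End K (∀ n, V n) where
  toFun A := filtSum fun n => (n.factorial : K)⁻¹ • (G.rightMul Y ^ n) A
  map_add' A B := by simp only [map_add, smul_add, filtSum_add]
  map_smul' c A := by
    simp only [map_smul, RingHom.id_apply]
    rw [← filtSum_smul]
    congr 1
    funext n
    exact smul_comm _ _ _

theorem expMul_apply (A : ∀ n, V n) :
    G.expMul Y A = filtSum fun n => (n.factorial : K)⁻¹ • (G.rightMul Y ^ n) A := rfl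

/-- The action of `exp Y` is unipotent: all terms but the zeroth raise the degree. Injectivity
follows. -/
theorem expMul_sub_mem_filt {n : ℕ} {A : ∀ n, V n} (hA : A ∈ filt K V n) :
    G.expMul Y A - A ∈ filt K V (n + 1) := by
  intro m hm
  have h : ∀ i ∈ Finset.range m,
      ((i + 1).factorial : K)⁻¹ • (G.rightMul Y ^ (i + 1)) A m = 0 := fun i _ => by
    rw [G.rightMul_pow_mem_filt Y hA (i + 1) m (by omega), smul_zero]
  rw [Pi.sub_apply, expMul_apply]
  simp only [filtSum, Pi.smul_apply]
  rw [Finset.sum_range_succ', Finset.sum_eq_zero h]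
  simp

theorem expMul_injective : Function.Injective (G.expMul Y) := by
  rw [injective_iff_map_eq_zero]
  intro A hA
  have h : ∀ n, A ∈ filt K V n := by
    intro n
    induction n with
    | zero => exact mem_filt_zero A
    | succ n ih =>
      have h := G.expMul_sub_mem_filt Y ih
      rw [hA, zero_sub] at h
      simpa using Submodule.neg_mem _ h
  funext n
  exact h (n + 1) n n.lt_succ_self

theorem expMul_filtSum {a : ℕ → ∀ n, V n} (ha : ∀ k, a k ∈ filt K V k) :
    G.expMul Y (filtSum a) = filtSum fun n =>
      ∑ p ∈ antidiagonal n, (p.1.factorial : K)⁻¹ • (G.rightMul Y ^ p.1) (a p.2) := by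
  have h : ∀ i, ∀ n, ∀ A ∈ filt K V n,
      ((i.factorial : K)⁻¹ • (G.rightMul Y ^ i)) A ∈ filt K V n := fun i n A hA =>
    Submodule.smul_mem _ _ (filt_anti (Nat.le_add_left n i) (G.rightMul_pow_mem_filt Y hA i))
  rw [← filtSum_filtSum (a := fun i k => (i.factorial : K)⁻¹ • (G.rightMul Y ^ i) (a k))
    (fun i k => Submodule.smul_mem _ _ (G.rightMul_pow_mem_filt Y (ha k) i)), expMul_apply]
  congr 1
  funext i
  exact map_filtSum (h i) ha

theorem adjoint_pow_mem_filt {n : ℕ} {B : ∀ n, V n} (hB : B ∈ filt K V n) (k : ℕ) :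
    (G.adjoint Y ^ k) B ∈ filt K V (k + n) := by
  induction k with
  | zero => simpa using hB
  | succ k ih =>
    rw [pow_succ', Module.End.mul_apply, show k + 1 + n = k + n + 1 by omega]
    exact G.adjoint_mem_filt Y ih

theorem rightMul_adjoint_pow (B : ∀ n, V n) (k : ℕ) :
    G.rightMul ((G.adjoint Y ^ k) B) * G.rightMul Y =
      G.rightMul Y * G.rightMul ((G.adjoint Y ^ k) B) + G.rightMul ((G.adjoint Y ^ (k + 1)) B) := by
  rw [rightMul_mul_rightMul, pow_succ', Module.End.mul_apply]

theorem rightMul_filtSum {a : ℕ → ∀ n, V n} (ha : ∀ k, a k ∈ filt K V k) (A : ∀ n, V n) :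
    G.mul A (filtSum a) = filtSum fun k => G.mul A (a k) :=
  map_filtSum (T := G.mul A) (fun n _ hB => filt_anti (Nat.le_add_left n 0)
    (G.mul_mem_filt (mem_filt_zero A) hB)) ha

variable [CharZero K]

theorem expMul_filtSum_inv_factorial {a : ℕ → ∀ n, V n} (ha : ∀ k, a k ∈ filt K V k) :
    G.expMul Y (filtSum fun k => (k.factorial : K)⁻¹ • a k) = filtSum fun n =>
      (n.factorial : K)⁻¹ • ∑ p ∈ antidiagonal n,
        n.choose p.1 • (G.rightMul Y ^ p.1) (a p.2) := by
  rw [expMul_filtSum _ _ fun k => Submodule.smul_mem _ _ (ha k)]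
  congr 1
  funext n
  rw [Finset.smul_sum]
  refine Finset.sum_congr rfl fun p hp => ?_
  obtain rfl := mem_antidiagonal.mp hp
  rw [inv_factorial_smul_choose, map_smul]

/-- Moving an operator across the action of `exp Y`. -/
theorem apply_expMul {x : ℕ → Module.End K (∀ n, V n)}
    (hx : ∀ k, x k * G.rightMul Y = G.rightMul Y * x k + x (k + 1))
    (hfilt : ∀ k n, ∀ A ∈ filt K V n, x k A ∈ filt K V (n + k)) (A : ∀ n, V n) :
    x 0 (G.expMul Y A) = G.expMul Y (filtSum fun k => (k.factorial : K)⁻¹ • x k A) := by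
  rw [G.expMul_filtSum_inv_factorial Y
      (fun k => by simpa using hfilt k 0 A (mem_filt_zero A)), expMul_apply,
    map_filtSum (hfilt 0) (G.inv_factorial_smul_pow_mem_filt Y A)]
  congr 1
  funext n
  rw [map_smul, ← Module.End.mul_apply, mul_pow_of_commutator _ _ hx]
  simp [LinearMap.sum_apply]

/-- This is `apply_expMul` evaluated at a formal unit 1, where 1 ↶ Y = Y, `e k` stands for the value
of `x k` at 1, and 1 ↶ exp Y = 1 + d. The hypothesis `hxe` is the commutation relation `hx` at 1. -/
theorem apply_add_eq_expMul {x : ℕ → Module.End K (∀ n, V n)} {e : ℕ → ∀ n, V n}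
    {d : ∀ n, V n} (hd : d = filtSum fun n => ((n + 1).factorial : K)⁻¹ • (G.rightMul Y ^ n) Y)
    (hx : ∀ k, x k * G.rightMul Y = G.rightMul Y * x k + x (k + 1))
    (hfilt : ∀ n, ∀ A ∈ filt K V n, x 0 A ∈ filt K V n)
    (hxe : ∀ k, x k Y = e (k + 1) + G.rightMul Y (e k))
    (he : ∀ k, e k ∈ filt K V k) :
    x 0 d + e 0 = G.expMul Y (filtSum fun k => (k.factorial : K)⁻¹ • e k) := by
  have hmem : ∀ n, (n.factorial : K)⁻¹ • ∑ p ∈ antidiagonal n,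
      n.choose p.1 • (G.rightMul Y ^ p.1) (e p.2) ∈ filt K V n := fun n =>
    Submodule.smul_mem _ _ (Submodule.sum_mem _ fun p hp => by
      rw [← Nat.cast_smul_eq_nsmul K]
      have h := G.rightMul_pow_mem_filt Y (he p.2) p.1
      rw [mem_antidiagonal.mp hp] at h
      exact Submodule.smul_mem _ _ h)
  rw [G.expMul_filtSum_inv_factorial Y he, filtSum_succ hmem, hd,
    map_filtSum hfilt fun n => Submodule.smul_mem _ _
      (G.rightMul_pow_mem_filt Y (mem_filt_zero Y) n), add_comm]
  congr 1
  · simp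
  · congr 1
    funext n
    rw [map_smul, ← Module.End.mul_apply, mul_pow_of_commutator _ _ hx,
      sum_antidiagonal_choose_succ_smul (fun i k => (G.rightMul Y ^ i) (e k)),
      LinearMap.sum_apply]
    congr 1
    refine Finset.sum_congr rfl fun p _ => ?_
    rw [LinearMap.smul_apply, Module.End.mul_apply, zero_add, hxe, map_add, pow_succ,
      Module.End.mul_apply]

/-- The product by `B` on the right, conjugated by the action of `exp Y`. -/
theorem exists_mul_expMul {d : ∀ n, V n}
    (hd : d = filtSum fun n => ((n + 1).factorial : K)⁻¹ • (G.rightMul Y ^ n) Y)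
    (B : ∀ n, V n) : ∃ B', G.expMul Y B' = B + G.mul d B ∧
      ∀ A, G.mul (G.expMul Y A) B = G.expMul Y (G.mul A B') := by
  have he : ∀ k, (G.adjoint Y ^ k) B ∈ filt K V k := fun k =>
    G.adjoint_pow_mem_filt Y (mem_filt_zero B) k
  have hfilt : ∀ k n, ∀ A ∈ filt K V n, G.rightMul ((G.adjoint Y ^ k) B) A ∈ filt K V (n + k) :=
    fun k n A hA => G.mul_mem_filt hA (he k)
  -- The witness is exp(ad Y) applied to `B`.
  refine ⟨filtSum fun k => (k.factorial : K)⁻¹ • (G.adjoint Y ^ k) B, ?_, fun A => ?_⟩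
  · rw [← G.apply_add_eq_expMul Y (x := fun k => G.rightMul ((G.adjoint Y ^ k) B)) hd
      (G.rightMul_adjoint_pow Y B) (hfilt 0) (fun k => ?_) he]
    · rw [add_comm]; rfl
    · rw [pow_succ', Module.End.mul_apply]
      exact G.mul_eq_adjoint_add Y _
  · rw [G.rightMul_filtSum fun k => Submodule.smul_mem _ _ (he k)]
    have h := G.apply_expMul Y (x := fun k => G.rightMul ((G.adjoint Y ^ k) B))
      (G.rightMul_adjoint_pow Y B) hfilt A
    refine h.trans ?_
    simp only [map_smul]
    rfl

/-- The degree operator, conjugated by the action of `exp Y`. -/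
theorem exists_degree_expMul {d : ∀ n, V n}
    (hd : d = filtSum fun n => ((n + 1).factorial : K)⁻¹ • (G.rightMul Y ^ n) Y) :
    ∃ C, G.expMul Y C = gradedDegree K V d ∧ ∀ A, gradedDegree K V (G.expMul Y A) =
      G.expMul Y (gradedDegree K V A + G.mul A C) := by
  set b : ℕ → ∀ n, V n := fun k => (G.adjoint Y ^ k) (gradedDegree K V Y) with hb
  -- `x` lists the iterated commutators of the degree operator with right multiplication by `Y`: the
  -- first is right multiplication by deg Y, and each later one applies ad Y once more. `e` lists
  -- their values at the formal unit; `e 0 = 0` because the unit has degree 0.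
  let e : ℕ → ∀ n, V n := fun k => Nat.casesOn k 0 b
  let x : ℕ → Module.End K (∀ n, V n) := fun k =>
    Nat.casesOn k (gradedDegree K V) fun j => G.rightMul (b j)
  have he : ∀ k, e k ∈ filt K V k := by
    rintro (_ | k)
    · exact mem_filt_zero _
    · exact G.adjoint_pow_mem_filt Y (G.mem_filt_one _) k
  have hx : ∀ k, x k * G.rightMul Y = G.rightMul Y * x k + x (k + 1) := by
    rintro (_ | k)
    · exact LinearMap.ext fun A => G.degree_mul A Y
    · exact G.rightMul_adjoint_pow Y _ k
  have hfilt : ∀ k n, ∀ A ∈ filt K V n, x k A ∈ filt K V (n + k) := by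
    rintro (_ | k) n A hA
    · exact gradedDegree_mem_filt hA
    · exact G.mul_mem_filt hA (he (k + 1))
  have hxe : ∀ k, x k Y = e (k + 1) + G.rightMul Y (e k) := by
    rintro (_ | k)
    · change gradedDegree K V Y = (G.adjoint Y ^ 0) (gradedDegree K V Y) + G.rightMul Y 0
      simp
    · change G.mul Y (b k) = (G.adjoint Y ^ (k + 1)) (gradedDegree K V Y) + G.rightMul Y (b k)
      rw [pow_succ', Module.End.mul_apply]
      exact G.mul_eq_adjoint_add Y _
  have hee : ∀ k, (k.factorial : K)⁻¹ • e k ∈ filt K V k := fun k => Submodule.smul_mem _ _ (he k)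
  refine ⟨filtSum fun k => (k.factorial : K)⁻¹ • e k, ?_, fun A => ?_⟩
  · rw [← G.apply_add_eq_expMul Y hd hx (hfilt 0) hxe he]
    exact add_zero _
  · refine (G.apply_expMul Y hx hfilt A).trans ?_
    congr 1
    rw [filtSum_succ fun k => Submodule.smul_mem _ _ (by
        simpa using hfilt k 0 A (mem_filt_zero A)), G.rightMul_filtSum hee,
      filtSum_succ (a := fun k => G.mul A ((k.factorial : K)⁻¹ • e k))
        fun k => filt_anti (Nat.le_add_left k 0) (G.mul_mem_filt (mem_filt_zero A) (hee k))]
    congr 1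
    · simp [x]
    · have h0 : G.mul A ((Nat.factorial 0 : K)⁻¹ • e 0) = 0 := by
        change G.mul A ((Nat.factorial 0 : K)⁻¹ • 0) = 0
        simp
      rw [h0, zero_add]
      simp only [map_smul]
      rfl

end GradedPreLie

end Exponential

-- The expansion of the solution of the q-equation

section QSeries

/-- A q-Newton expansion of 1 − log_q x at x = q^(a+1). The factor with `i = a` kills every term
with `k ≥ a`, so any truncation at `N ≥ a` gives the same value. -/
theorem sum_prod_one_sub_div {K : Type} [Field K] {q : K} (hq : q ≠ 0)
    (hq1 : ∀ k : ℕ, q ^ (k + 1) - 1 ≠ 0) (N : ℕ) : ∀ a ≤ N,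
    ∑ k ∈ Finset.range N, (q ^ (k + 1) - 1)⁻¹ *
      ∏ i ∈ Finset.range (k + 1), (1 - (q ^ (i + 1))⁻¹ * q ^ (a + 1)) = -(a : K) := by
  intro a
  induction a with
  | zero =>
    intro _
    rw [Nat.cast_zero, neg_zero]
    refine Finset.sum_eq_zero fun k _ => ?_
    rw [Finset.prod_range_succ', zero_add, inv_mul_cancel₀ (pow_ne_zero _ hq), sub_self, mul_zero,
      mul_zero]
  | succ a ih =>
    intro ha
    set p : ℕ → K := fun k => ∏ i ∈ Finset.range k, (1 - (q ^ (i + 1))⁻¹ * q ^ (a + 1)) with hp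
    -- Raising `a` by one shifts the factors by one index and leaves a new first factor, 1 −
    -- q^(a+1).
    have hp1 : ∀ k, ∏ i ∈ Finset.range (k + 1), (1 - (q ^ (i + 1))⁻¹ * q ^ (a + 1 + 1)) =
        p k * (1 - q ^ (a + 1)) := fun k => by
      rw [Finset.prod_range_succ']
      congr 1
      · refine Finset.prod_congr rfl fun i _ => ?_
        field_simp
        ring
      · field_simp
        ring
    have hpN : p N = 0 := Finset.prod_eq_zero (Finset.mem_range.mpr ha)
      (by rw [inv_mul_cancel₀ (pow_ne_zero _ hq), sub_self])
    -- Each term is the corresponding term for `a` plus a telescoping difference, whose total is p N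
    -- − p 0 = −1.
    have hterm : ∀ k, (q ^ (k + 1) - 1)⁻¹ * (p k * (1 - q ^ (a + 1))) =
        (q ^ (k + 1) - 1)⁻¹ * p (k + 1) + (p (k + 1) - p k) := fun k => by
      have h : p (k + 1) = p k * (1 - (q ^ (k + 1))⁻¹ * q ^ (a + 1)) := Finset.prod_range_succ _ _
      have h1 := hq1 k
      rw [h]
      field_simp
      ring
    simp only [hp1, hterm]
    rw [Finset.sum_add_distrib, ih (Nat.le_of_succ_le ha), Finset.sum_range_sub, hpN]
    simp only [hp, Finset.range_zero, Finset.prod_empty]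
    push_cast
    ring

variable {K : Type} {V : ℕ → Type} [Field K] [∀ n, AddCommGroup (V n)] [∀ n, Module K (V n)]

theorem mem_filt_of_smul_mem {n : ℕ} {c : K} (hc : c ≠ 0) {A : ∀ n, V n}
    (h : c • A ∈ filt K V n) : A ∈ filt K V n :=
  ((filt K V n).smul_mem_iff hc).mp h

theorem gradedShift_sub_mem_filt (q : K) {n : ℕ} {A : ∀ n, V n} (hA : A ∈ filt K V n) :
    gradedShift V q A - q ^ n • A ∈ filt K V (n + 1) := by
  intro m hm
  change q ^ m • A m - q ^ n • A m = 0
  rcases Nat.lt_succ_iff_lt_or_eq.mp hm with h | rfl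
  · rw [hA m h, smul_zero, smul_zero, sub_zero]
  · rw [sub_self]

theorem gradedShift_mem_filt (q : K) {n : ℕ} {A : ∀ n, V n} (hA : A ∈ filt K V n) :
    gradedShift V q A ∈ filt K V n := fun m hm => by
  change q ^ m • A m = 0
  rw [hA m hm, smul_zero]

theorem gradedDegree_sub_mem_filt {n : ℕ} {A : ∀ n, V n} (hA : A ∈ filt K V n) :
    gradedDegree K V A - (n : K) • A ∈ filt K V (n + 1) := by
  intro m hm
  change (m : K) • A m - (n : K) • A m = 0
  rcases Nat.lt_succ_iff_lt_or_eq.mp hm with h | rfl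
  · rw [hA m h, smul_zero, smul_zero, sub_zero]
  · rw [sub_self]

namespace GradedPreLie

variable (G : GradedPreLie K V) (Y : ∀ n, V n) (q : K)

/-- The action of `exp Y` composed with the `q`-shift. -/
def shiftExp : Module.End K (∀ n, V n) := G.expMul Y * gradedShift V q

theorem shiftExp_sub_mem_filt {n : ℕ} {A : ∀ n, V n} (hA : A ∈ filt K V n) :
    G.shiftExp Y q A - q ^ n • A ∈ filt K V (n + 1) := by
  have h := Submodule.add_mem _ (G.expMul_sub_mem_filt Y (gradedShift_mem_filt q hA))
    (gradedShift_sub_mem_filt q hA)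
  rwa [sub_add_sub_cancel] at h

-- In degree n ≥ 1 the leading term is multiplied by qⁿ − 1 ≠ 0, so it vanishes as long as n < N;
-- degree 0 is empty.
variable {q} in
theorem mem_filt_of_shiftExp_sub_mem (hq1 : ∀ k : ℕ, q ^ (k + 1) - 1 ≠ 0) {N : ℕ} {A : ∀ n, V n}
    (hA : G.shiftExp Y q A - A ∈ filt K V N) : A ∈ filt K V N := by
  have h : ∀ n ≤ N, A ∈ filt K V n := by
    intro n
    induction n with
    | zero => exact fun _ => mem_filt_zero A
    | succ n ih =>
      intro hn
      rcases Nat.eq_zero_or_pos n with rfl | hpos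
      · exact G.mem_filt_one A
      · obtain ⟨k, rfl⟩ := Nat.exists_eq_succ_of_ne_zero hpos.ne'
        have h := Submodule.sub_mem _ (filt_anti hn hA)
          (G.shiftExp_sub_mem_filt Y q (ih (Nat.le_of_succ_le hn)))
        refine mem_filt_of_smul_mem (hq1 k) ?_
        convert h using 1
        module
  exact h N le_rfl

/-- An operator that commutes with `shiftExp` and raises degrees is zero. -/
theorem apply_mem_filt_of_commute (hq : q ≠ 0) (hq1 : ∀ k : ℕ, q ^ (k + 1) - 1 ≠ 0)
    {T : Module.End K (∀ n, V n)} (hT : Commute T (G.shiftExp Y q)) {N : ℕ}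
    (hN : ∀ n ≤ N, ∀ A ∈ filt K V n, T A ∈ filt K V (n + 1)) (A : ∀ n, V n) :
    T A ∈ filt K V (N + 1) := by
  have h : ∀ r n, n + r ≤ N → ∀ A ∈ filt K V n, T A ∈ filt K V (n + r + 1) := by
    intro r
    induction r with
    | zero => exact fun n hn A hA => hN n hn A hA
    | succ r ih =>
      intro n hn A hA
      have h1 := ih n (by omega) A hA
      -- The leading term cancels, so the induction hypothesis applied to this element gains one
      -- degree. Since `T` commutes with `shiftExp`, its image is T A − q⁻ⁿ E(T A), whose leading
      -- term is (1 − q^(r+1)) times that of T A; hence T A gains a degree too.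
      have h2 : A - (q ^ n)⁻¹ • G.shiftExp Y q A ∈ filt K V (n + 1) := by
        have h := Submodule.smul_mem _ (-(q ^ n)⁻¹) (G.shiftExp_sub_mem_filt Y q hA)
        rw [smul_sub, smul_smul, neg_mul, inv_mul_cancel₀ (pow_ne_zero n hq)] at h
        convert h using 1
        module
      have h3 := ih (n + 1) (by omega) _ h2
      have h4 := G.shiftExp_sub_mem_filt Y q h1
      have h5 : T (G.shiftExp Y q A) = G.shiftExp Y q (T A) := LinearMap.congr_fun hT.eq A
      rw [map_sub, map_smul, h5, show n + 1 + r + 1 = n + r + 1 + 1 by omega] at h3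
      have h6 := Submodule.add_mem _ h3 (Submodule.smul_mem _ (q ^ n)⁻¹ h4)
      rw [show n + (r + 1) + 1 = n + r + 1 + 1 by omega]
      refine mem_filt_of_smul_mem (neg_ne_zero.mpr (hq1 r)) ?_
      convert h6 using 1
      have h7 : (q ^ n)⁻¹ * q ^ (n + r + 1) = q ^ (r + 1) := by
        rw [add_assoc, pow_add, inv_mul_cancel_left₀ (pow_ne_zero n hq)]
      rw [smul_sub, smul_smul, h7]
      module
  have h0 := h N 0 (by omega) A (mem_filt_zero A)
  rwa [zero_add] at h0

/-- The partial products of `∏ i ≥ 1, (1 - q⁻ⁱ E)`, where `E` is `shiftExp`. -/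
def shiftExpProd : ℕ → Module.End K (∀ n, V n)
  | 0 => 1
  | k + 1 => (1 - (q ^ (k + 1))⁻¹ • G.shiftExp Y q) * shiftExpProd k

theorem shiftExpProd_succ_apply (k : ℕ) (A : ∀ n, V n) : G.shiftExpProd Y q (k + 1) A =
    G.shiftExpProd Y q k A - (q ^ (k + 1))⁻¹ • G.shiftExp Y q (G.shiftExpProd Y q k A) := rfl

theorem commute_shiftExpProd (k : ℕ) :
    Commute (G.shiftExpProd Y q k) (G.shiftExp Y q) := by
  induction k with
  | zero => exact Commute.one_left _
  | succ k ih =>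
    exact ((Commute.one_left _).sub_left ((Commute.refl _).smul_left _)).mul_left ih

/-- The diagonal part of a polynomial in a triangular operator is that polynomial in the diagonal
scalar qⁿ. -/
theorem shiftExpProd_sub_mem_filt {n : ℕ} {A : ∀ n, V n} (hA : A ∈ filt K V n) (k : ℕ) :
    G.shiftExpProd Y q k A - (∏ i ∈ Finset.range k, (1 - (q ^ (i + 1))⁻¹ * q ^ n)) • A ∈
      filt K V (n + 1) := by
  have hmem : ∀ B ∈ filt K V n, ∀ m : ℕ,
      (B - (q ^ m)⁻¹ • G.shiftExp Y q B) - (1 - (q ^ m)⁻¹ * q ^ n) • B ∈ filt K V (n + 1) := by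
    intro B hB m
    convert Submodule.smul_mem _ (-(q ^ m)⁻¹) (G.shiftExp_sub_mem_filt Y q hB) using 1
    module
  induction k with
  | zero =>
    change A - _ ∈ _
    simp
  | succ k ih =>
    set c := ∏ i ∈ Finset.range k, (1 - (q ^ (i + 1))⁻¹ * q ^ n)
    have hB : G.shiftExpProd Y q k A ∈ filt K V n := by
      have h := Submodule.add_mem _ (filt_anti n.le_succ ih) (Submodule.smul_mem _ c hA)
      rwa [sub_add_cancel] at h
    rw [Finset.prod_range_succ, shiftExpProd_succ_apply]
    convert Submodule.add_mem _ (hmem _ hB (k + 1))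
      (Submodule.smul_mem _ (1 - (q ^ (k + 1))⁻¹ * q ^ n) ih) using 1
    module

/-- Every element starts in degree 1 at least, and the factor 1 − q⁻ⁱE kills the leading term in
degree `i`. -/
theorem shiftExpProd_mem_filt (hq : q ≠ 0) (A : ∀ n, V n) (k : ℕ) :
    G.shiftExpProd Y q k A ∈ filt K V (k + 1) := by
  induction k with
  | zero => exact G.mem_filt_one A
  | succ k ih =>
    rw [shiftExpProd_succ_apply]
    have h := Submodule.smul_mem _ (-(q ^ (k + 1))⁻¹) (G.shiftExp_sub_mem_filt Y q ih)
    rw [smul_sub, smul_smul, neg_mul, inv_mul_cancel₀ (pow_ne_zero _ hq)] at h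
    convert h using 1
    module

variable [CharZero K]

/-- The degree operator, corrected so as to commute with `shiftExp`. -/
theorem commute_degree_add_rightMul {d U : ∀ n, V n}
    (hd : d = filtSum fun n => ((n + 1).factorial : K)⁻¹ • (G.rightMul Y ^ n) Y)
    (hd1 : gradedDegree K V d = d)
    (hU : G.shiftExp Y q U - U = G.mul d U + (q - 1) • d) :
    Commute ((q - 1) • gradedDegree K V + G.rightMul U) (G.shiftExp Y q) := by
  obtain ⟨U', hU', hmul⟩ := G.exists_mul_expMul Y hd U
  obtain ⟨C, hC, hdeg⟩ := G.exists_degree_expMul Y hd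
  -- `C` and `U'` are the corrections created by moving the degree operator and right multiplication
  -- by `U` across exp Y. The q-equation says that their combination has the same image under exp Y
  -- as the shift of `U`.
  have key : (q - 1) • C + U' = gradedShift V q U := by
    apply G.expMul_injective Y
    rw [map_add, map_smul, hC, hd1, hU']
    change _ = G.shiftExp Y q U
    rw [sub_eq_iff_eq_add.mp hU]
    abel
  have hcomm : ∀ A : ∀ n, V n,
      gradedDegree K V (gradedShift V q A) = gradedShift V q (gradedDegree K V A) := fun A => by
    funext n
    exact smul_comm _ _ _
  refine LinearMap.ext fun A => ?_
  change (q - 1) • gradedDegree K V (G.expMul Y (gradedShift V q A)) +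
      G.mul (G.expMul Y (gradedShift V q A)) U =
    G.expMul Y (gradedShift V q ((q - 1) • gradedDegree K V A + G.mul A U))
  rw [hdeg, hmul, ← map_smul, ← map_add, map_add (gradedShift V q), map_smul (gradedShift V q),
    G.shift_mul, ← key, hcomm]
  simp only [map_add, map_smul, smul_add, add_assoc]

/-- The solution of the `q`-equation as a combination, with denominators the `q`-integers, of
the partial products applied to the generator. -/
theorem eq_sum_shiftExpProd {d U : ∀ n, V n} (hq : q ≠ 0) (hq1 : ∀ k : ℕ, q ^ (k + 1) - 1 ≠ 0)
    (hd : d = filtSum fun n => ((n + 1).factorial : K)⁻¹ • (G.rightMul Y ^ n) Y)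
    (hd1 : gradedDegree K V d = d)
    (hU : G.shiftExp Y q U - U = G.mul d U + (q - 1) • d) (n : ℕ) :
    U n = ∑ k ∈ Finset.range n,
      ((q - 1) * (q ^ (k + 1) - 1)⁻¹) • G.shiftExpProd Y q k d n := by
  have hq0 : q - 1 ≠ 0 := by simpa using hq1 0
  set s : ℕ → K := fun k => (q - 1) * (q ^ (k + 1) - 1)⁻¹ with hs
  set P := G.shiftExpProd Y q with hP
  -- Truncated difference between (q − 1)·deg + R_U and its expansion in the partial products. The
  -- diagonal contributions in degree a + 1 are (q − 1)(a + 1), −(q − 1) and −(q − 1)a, which add up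
  -- to zero.
  set T : Module.End K (∀ n, V n) :=
    ((q - 1) • gradedDegree K V + G.rightMul U) - (q - 1) • (1 : Module.End K (∀ n, V n)) +
      ∑ k ∈ Finset.range n, s k • P (k + 1) with hT
  have hTcomm : Commute T (G.shiftExp Y q) :=
    ((G.commute_degree_add_rightMul Y q hd hd1 hU).sub_left
      ((Commute.one_left _).smul_left _)).add_left
      (Commute.sum_left _ _ _ fun k _ => (G.commute_shiftExpProd Y q (k + 1)).smul_left _)
  have hTapply : ∀ A, T A = (q - 1) • gradedDegree K V A + G.mul A U - (q - 1) • A +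
      ∑ k ∈ Finset.range n, s k • P (k + 1) A := fun A => by
    simp only [hT, LinearMap.add_apply, LinearMap.sub_apply, LinearMap.smul_apply,
      LinearMap.sum_apply, Module.End.one_apply]
    rfl
  have hTd : T d ∈ filt K V (n + 1 + 1) := by
    -- The degrees m = a + 1 ≤ n + 1 to be checked are those with a ≤ n, for which `n` terms of the
    -- q-Newton sum suffice.
    refine G.apply_mem_filt_of_commute Y q hq hq1 hTcomm (fun m hm A hA => ?_) d
    rcases m with _ | a
    · exact G.mem_filt_one _
    have h1 := Submodule.smul_mem _ (q - 1) (gradedDegree_sub_mem_filt hA)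
    have h2 : G.mul A U ∈ filt K V (a + 1 + 1) := G.rightMul_mem_filt U hA
    have h3 := Submodule.sum_mem (filt K V (a + 1 + 1)) fun k (_ : k ∈ Finset.range n) =>
      Submodule.smul_mem _ (s k) (G.shiftExpProd_sub_mem_filt Y q hA (k + 1))
    have h4 : ∑ k ∈ Finset.range n, s k *
        ∏ i ∈ Finset.range (k + 1), (1 - (q ^ (i + 1))⁻¹ * q ^ (a + 1)) = -((q - 1) * a) := by
      simp only [hs, mul_assoc]
      rw [← Finset.mul_sum, sum_prod_one_sub_div hq hq1 n a (by omega), mul_neg]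
    simp only [smul_sub, Finset.sum_sub_distrib, smul_smul, ← Finset.sum_smul] at h3
    rw [h4] at h3
    convert Submodule.add_mem _ (Submodule.add_mem _ h1 h2) h3 using 1
    rw [hTapply]
    push_cast
    module
  have hPn : P n d ∈ filt K V (n + 1) := G.shiftExpProd_mem_filt Y q hq d n
  set W := ∑ k ∈ Finset.range n, s k • P k d with hW
  have hEW : G.shiftExp Y q W - W = (q - 1) • d - (q - 1) • P n d -
      ∑ k ∈ Finset.range n, s k • P (k + 1) d := by
    -- With s k (q^(k+1) − 1) = q − 1, applying E − 1 gives a telescoping part and the terms already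
    -- present in `T d`.
    have hE : ∀ k, s k • G.shiftExp Y q (P k d) - s k • P k d =
        (q - 1) • (P k d - P (k + 1) d) - s k • P (k + 1) d := fun k => by
      have h0 := hq1 k
      have h1 : P (k + 1) d = P k d - (q ^ (k + 1))⁻¹ • G.shiftExp Y q (P k d) := rfl
      have h2 : s k * (q ^ (k + 1))⁻¹ + (q - 1) * (q ^ (k + 1))⁻¹ = s k := by
        simp only [hs]
        field_simp
        ring
      rw [h1]
      nth_rewrite 1 [← h2]
      module
    have hP0 : P 0 d = d := rfl
    rw [hW, map_sum, ← Finset.sum_sub_distrib]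
    simp only [map_smul, hE]
    rw [Finset.sum_sub_distrib, ← Finset.smul_sum, Finset.sum_range_sub', hP0, smul_sub]
  -- E − 1 sends U − W to T d + (q − 1) P n d, which has no component of degree at most `n`.
  have hdiff : U - W ∈ filt K V (n + 1) := by
    refine G.mem_filt_of_shiftExp_sub_mem Y hq1 ?_
    convert Submodule.add_mem _ (filt_anti (Nat.le_succ _) hTd)
      (Submodule.smul_mem _ (q - 1) hPn) using 1
    rw [hTapply, hd1, map_sub, sub_sub_sub_comm, hU, hEW]
    abel
  have h := hdiff n n.lt_succ_self
  rw [Pi.sub_apply, sub_eq_zero] at h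
  rw [h, hW, Finset.sum_apply]
  rfl

end GradedPreLie

end QSeries

-- Rooted trees as a complete graded pre-Lie algebra

section Instantiation

/-- The homogeneous component of degree `n`, as a vector space in its own right. -/
def Component (K : Type) [Field K] (n : ℕ) : Type := homogeneous K n

variable {K : Type} [Field K]

instance (n : ℕ) : AddCommGroup (Component K n) :=
  (inferInstance : AddCommGroup (homogeneous K n))

instance (n : ℕ) : Module K (Component K n) := (homogeneous K n).module

/-- The underlying linear combination of trees. -/
def Component.val (n : ℕ) : Component K n →ₗ[K] PL K := (homogeneous K n).subtype

theorem Component.val_injective (n : ℕ) : Function.Injective (Component.val (K := K) n) :=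
  Subtype.val_injective

/-- An element of the completion, as a sequence of vectors of the spaces `Component K n`. -/
def toGraded (A : CPL K) (n : ℕ) : Component K n := A n

/-- The product of the completion. -/
def componentGraft (A B : ∀ n, Component K n) : ∀ n, Component K n :=
  toGraded (cgraft (K := K) A B)

theorem val_componentGraft (A B : ∀ n, Component K n) (n : ℕ) :
    Component.val n (componentGraft A B n) =
      ∑ p ∈ antidiagonal n, preLie K (Component.val p.1 (A p.1)) (Component.val p.2 (B p.2)) := rfl

/-- The product of the completion, as a bilinear map. -/
def cgraftLinear : (∀ n, Component K n) →ₗ[K] (∀ n, Component K n) →ₗ[K] (∀ n, Component K n) :=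
  LinearMap.mk₂ K componentGraft
    (fun A A' B => by
      funext n; apply Component.val_injective
      simp [val_componentGraft, Finset.sum_add_distrib])
    (fun c A B => by
      funext n; apply Component.val_injective
      simp [val_componentGraft, Finset.smul_sum])
    (fun A B B' => by
      funext n; apply Component.val_injective
      simp [val_componentGraft, Finset.sum_add_distrib])
    (fun c A B => by
      funext n; apply Component.val_injective
      simp [val_componentGraft, Finset.smul_sum])

theorem val_cgraftLinear (A B : ∀ n, Component K n) (n : ℕ) :
    Component.val n (cgraftLinear A B n) =
      ∑ p ∈ antidiagonal n, preLie K (Component.val p.1 (A p.1)) (Component.val p.2 (B p.2)) := rfl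

variable (K) in
/-- The completed pre-Lie algebra of rooted trees. -/
def treePreLie : GradedPreLie K (Component K) where
  mul := cgraftLinear
  mul_identity A B C := by
    funext n; apply Component.val_injective
    simp only [Pi.sub_apply, map_sub, val_cgraftLinear, map_sum, LinearMap.sum_apply]
    rw [sum_antidiagonal_assoc (fun i j k => preLie K (preLie K (Component.val i (A i))
        (Component.val j (B j))) (Component.val k (C k))),
      sum_antidiagonal_assoc (fun i j k => preLie K (preLie K (Component.val i (A i))
        (Component.val j (C j))) (Component.val k (B k))),
      ← Finset.sum_sub_distrib, ← Finset.sum_sub_distrib]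
    refine Finset.sum_congr rfl fun p _ => ?_
    rw [← Finset.Nat.sum_antidiagonal_swap (n := p.2) (f := fun r => preLie K (preLie K
        (Component.val p.1 (A p.1)) (Component.val r.1 (C r.1))) (Component.val r.2 (B r.2))),
      ← Finset.Nat.sum_antidiagonal_swap (n := p.2) (f := fun r => preLie K
        (Component.val p.1 (A p.1)) (preLie K (Component.val r.1 (C r.1))
          (Component.val r.2 (B r.2)))),
      ← Finset.sum_sub_distrib, ← Finset.sum_sub_distrib]
    refine Finset.sum_congr rfl fun r _ => ?_
    rw [← map_sub]
    exact preLie_identity _ _ _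
  mem_filt_one A m hm := by
    obtain rfl : m = 0 := by omega
    exact CPL.zero_eq A
  mul_mem_filt {a b A B} hA hB m hm := by
    apply Component.val_injective
    rw [val_cgraftLinear, map_zero]
    refine Finset.sum_eq_zero fun p hp => ?_
    have hp' := mem_antidiagonal.mp hp
    by_cases h : p.1 < a
    · rw [hA _ h]; simp
    · rw [hB p.2 (by omega)]; simp
  shift_mul q A B := by
    funext n; apply Component.val_injective
    change Component.val n (q ^ n • cgraftLinear A B n) = _
    rw [map_smul, val_cgraftLinear, val_cgraftLinear, Finset.smul_sum]
    refine Finset.sum_congr rfl fun p hp => ?_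
    change _ = preLie K (Component.val p.1 (q ^ p.1 • A p.1)) (Component.val p.2 (q ^ p.2 • B p.2))
    rw [map_smul, map_smul, map_smul, map_smul, LinearMap.smul_apply, smul_smul, ← pow_add,
      ← mem_antidiagonal.mp hp, add_comm]
  degree_mul A B := by
    funext n; apply Component.val_injective
    change Component.val n ((n : K) • cgraftLinear A B n) = _
    rw [Pi.add_apply, map_add, map_smul, val_cgraftLinear, val_cgraftLinear, val_cgraftLinear,
      Finset.smul_sum, ← Finset.sum_add_distrib]
    refine Finset.sum_congr rfl fun p hp => ?_
    change _ = preLie K (Component.val p.1 ((p.1 : K) • A p.1)) (Component.val p.2 (B p.2)) +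
      preLie K (Component.val p.1 (A p.1)) (Component.val p.2 ((p.2 : K) • B p.2))
    simp only [map_smul, LinearMap.smul_apply]
    rw [← add_smul, ← Nat.cast_add, mem_antidiagonal.mp hp]

theorem val_treePreLie_mul (A B : ∀ n, Component K n) (n : ℕ) :
    Component.val n ((treePreLie K).mul A B n) =
      ∑ p ∈ antidiagonal n, preLie K (Component.val p.1 (A p.1)) (Component.val p.2 (B p.2)) := rfl

theorem rightMul_pow_toGraded (Y A : CPL K) (k : ℕ) :
    ((treePreLie K).rightMul (toGraded Y) ^ k) (toGraded A) =
      toGraded ((fun Z => cgraft Z Y)^[k] A) :=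
  Module.End.pow_apply _ _ _

/-- `filtSum` also includes the term `k = n` in degree `n`; that term vanishes because each grafting
raises the degree. -/
theorem toGraded_actSeries (f : PowerSeries K) (Y X : CPL K) :
    toGraded (actSeries f Y X) = filtSum fun k =>
      PowerSeries.coeff k f • ((treePreLie K).rightMul (toGraded Y) ^ k) (toGraded X) := by
  funext n
  have h : ((treePreLie K).rightMul (toGraded Y) ^ n) (toGraded X) n = 0 := by
    rw [rightMul_pow_toGraded]
    exact iterate_cgraft_eq_zero X Y n n le_rfl
  simp only [filtSum]
  rw [Finset.sum_range_succ, Pi.smul_apply, h, smul_zero, add_zero]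
  simp only [rightMul_pow_toGraded]
  rfl

end Instantiation

-- The one-vertex tree in terms of Ω

section Generator

variable {K : Type} {V : ℕ → Type} [Field K] [∀ n, AddCommGroup (V n)] [∀ n, Module K (V n)]

/-- Powers of a single right multiplication commute, so power series in it compose by multiplication
of series. -/
theorem GradedPreLie.filtSum_coeff_mul (G : GradedPreLie K V) (Y : ∀ n, V n)
    (f g : PowerSeries K) (A : ∀ n, V n) :
    filtSum (fun n => PowerSeries.coeff n f • (G.rightMul Y ^ n)
      (filtSum fun k => PowerSeries.coeff k g • (G.rightMul Y ^ k) A)) =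
    filtSum fun n => PowerSeries.coeff n (f * g) • (G.rightMul Y ^ n) A := by
  have hmem : ∀ k, PowerSeries.coeff k g • (G.rightMul Y ^ k) A ∈ filt K V k := fun k =>
    Submodule.smul_mem _ _ (G.rightMul_pow_mem_filt Y (mem_filt_zero A) k)
  have h : ∀ i, ∀ n, ∀ A ∈ filt K V n,
      (PowerSeries.coeff i f • (G.rightMul Y ^ i)) A ∈ filt K V n := fun i n A hA =>
    Submodule.smul_mem _ _ (filt_anti (Nat.le_add_left n i) (G.rightMul_pow_mem_filt Y hA i))
  have h1 : (fun n => PowerSeries.coeff n f • (G.rightMul Y ^ n)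
      (filtSum fun k => PowerSeries.coeff k g • (G.rightMul Y ^ k) A)) = fun n =>
      filtSum fun k => PowerSeries.coeff n f • (G.rightMul Y ^ n)
        (PowerSeries.coeff k g • (G.rightMul Y ^ k) A) :=
    funext fun n => map_filtSum (h n) hmem
  rw [h1, filtSum_filtSum fun i k =>
    Submodule.smul_mem _ _ (G.rightMul_pow_mem_filt Y (hmem k) i)]
  congr 1
  funext n
  rw [PowerSeries.coeff_mul, Finset.sum_smul]
  refine Finset.sum_congr rfl fun p hp => ?_
  rw [map_smul, smul_smul, ← Module.End.mul_apply, ← pow_add, mem_antidiagonal.mp hp]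

/-- The series (exp x − 1)/x is inverse to the Bernoulli series x/(exp x − 1), so acting with it on
the defining equation of Ω recovers the one-vertex tree. -/
theorem toGraded_cdot_eq_filtSum : toGraded (cdot ℚ) = filtSum fun n =>
    ((n + 1).factorial : ℚ)⁻¹ •
      ((treePreLie ℚ).rightMul (toGraded Omega) ^ n) (toGraded Omega) := by
  set g : PowerSeries ℚ := PowerSeries.mk fun n => ((n + 1).factorial : ℚ)⁻¹ with hg
  have hgexp : g * PowerSeries.X = PowerSeries.exp ℚ - 1 := by
    ext n
    rcases n with _ | n
    · simp
    · rw [PowerSeries.coeff_succ_mul_X]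
      simp [hg, PowerSeries.coeff_mk, PowerSeries.coeff_exp, PowerSeries.coeff_one]
  have hmul : g * bernoulliPowerSeries ℚ = 1 := by
    have h : (g * bernoulliPowerSeries ℚ) * PowerSeries.X = 1 * PowerSeries.X := by
      rw [mul_right_comm, hgexp, mul_comm, bernoulliPowerSeries_mul_exp_sub_one, one_mul]
    exact mul_right_cancel₀ PowerSeries.X_ne_zero h
  have hO := (toGraded_actSeries (bernoulliPowerSeries ℚ) Omega (cdot ℚ)).symm.trans
    (congrArg toGraded isOmega_Omega)
  have h := (treePreLie ℚ).filtSum_coeff_mul (toGraded Omega) g (bernoulliPowerSeries ℚ)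
    (toGraded (cdot ℚ))
  rw [hO, hmul] at h
  have h1 : filtSum (fun n => PowerSeries.coeff n (1 : PowerSeries ℚ) •
      ((treePreLie ℚ).rightMul (toGraded Omega) ^ n) (toGraded (cdot ℚ))) =
        toGraded (cdot ℚ) := by
    rw [filtSum_succ fun n => Submodule.smul_mem _ _
      ((treePreLie ℚ).rightMul_pow_mem_filt _ (mem_filt_zero _) n)]
    funext n
    simp [filtSum, PowerSeries.coeff_one]
  rw [← h1, ← h]
  simp [hg, PowerSeries.coeff_mk]

end Generator

-- Extension of scalars to ℚ(q)

section Extension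

/-- Extension of scalars on finite combinations of trees. -/
def extendPL : PL ℚ →+ PL (RatFunc ℚ) :=
  Finsupp.mapRange.addMonoidHom (algebraMap ℚ (RatFunc ℚ)).toAddMonoidHom

theorem extendPL_smul (c : ℚ) (A : PL ℚ) :
    extendPL (c • A) = algebraMap ℚ (RatFunc ℚ) c • extendPL A := by
  ext T
  simp [extendPL]

theorem extendPL_single (T : RootedTree) : extendPL (Finsupp.single T 1) = Finsupp.single T 1 := by
  simp [extendPL]

theorem extendPL_preLie (A B : PL ℚ) :
    extendPL (preLie ℚ A B) = preLie (RatFunc ℚ) (extendPL A) (extendPL B) := by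
  induction A using Finsupp.induction_linear with
  | zero => simp
  | add f g hf hg => simp only [map_add, LinearMap.add_apply, hf, hg]
  | single T c =>
    induction B using Finsupp.induction_linear with
    | zero => simp
    | add f g hf hg => simp only [map_add, hf, hg]
    | single T' c' =>
      have h : ∀ (T : RootedTree) (c : ℚ), (Finsupp.single T c : PL ℚ) = c • Finsupp.single T 1 :=
        fun T c => by simp
      rw [h T c, h T' c']
      simp only [map_smul, LinearMap.smul_apply, extendPL_smul, extendPL_single, preLie_single,
        map_multiset_sum, Multiset.map_map, Function.comp_def]

/-- Extension of scalars. -/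
def extendGraded (A : ∀ n, Component ℚ n) : ∀ n, Component (RatFunc ℚ) n :=
  toGraded (extendScalars A)

theorem val_extendGraded (A : ∀ n, Component ℚ n) (n : ℕ) :
    Component.val n (extendGraded A n) = extendPL (Component.val n (A n)) := rfl

theorem extendGraded_mul (A B : ∀ n, Component ℚ n) :
    extendGraded ((treePreLie ℚ).mul A B) =
      (treePreLie (RatFunc ℚ)).mul (extendGraded A) (extendGraded B) := by
  funext n
  apply Component.val_injective
  rw [val_extendGraded, val_treePreLie_mul, val_treePreLie_mul, map_sum]
  refine Finset.sum_congr rfl fun p _ => ?_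
  rw [extendPL_preLie, val_extendGraded, val_extendGraded]

theorem extendGraded_rightMul_pow (Y A : ∀ n, Component ℚ n) (n : ℕ) :
    extendGraded (((treePreLie ℚ).rightMul Y ^ n) A) =
      ((treePreLie (RatFunc ℚ)).rightMul (extendGraded Y) ^ n) (extendGraded A) := by
  induction n with
  | zero => rw [pow_zero, pow_zero, Module.End.one_apply, Module.End.one_apply]
  | succ n ih =>
    rw [pow_succ', pow_succ', Module.End.mul_apply, Module.End.mul_apply, ← ih,
      GradedPreLie.rightMul_apply, GradedPreLie.rightMul_apply, extendGraded_mul]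

theorem extendGraded_cdot : extendGraded (toGraded (cdot ℚ)) = toGraded (cdot (RatFunc ℚ)) := by
  funext n
  apply Component.val_injective
  by_cases h : n = 1
  · subst h
    have h1 : ∀ (K : Type) [Field K], Component.val 1 (toGraded (cdot K) 1) =
        Finsupp.single RootedTree.dot 1 := fun K _ => by
      change ((cdot K 1 : homogeneous K 1) : PL K) = _
      rw [cdot, Pi.single_eq_same]
    rw [val_extendGraded, h1, h1, extendPL_single]
  · have h0 : ∀ (K : Type) [Field K], toGraded (cdot K) n = 0 := fun K _ =>
      Pi.single_eq_of_ne h _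
    rw [val_extendGraded, h0, h0, map_zero, map_zero, map_zero]

theorem toGraded_cdot_ratFunc_eq_filtSum : toGraded (cdot (RatFunc ℚ)) = filtSum fun n =>
    ((n + 1).factorial : RatFunc ℚ)⁻¹ •
      ((treePreLie (RatFunc ℚ)).rightMul (extendGraded (toGraded Omega)) ^ n)
        (extendGraded (toGraded Omega)) := by
  funext m
  apply Component.val_injective
  rw [← extendGraded_cdot, val_extendGraded, toGraded_cdot_eq_filtSum]
  simp only [filtSum, map_sum, Pi.smul_apply, map_smul, extendPL_smul]
  refine Finset.sum_congr rfl fun n _ => ?_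
  rw [← extendGraded_rightMul_pow, val_extendGraded, map_inv₀, map_natCast]

theorem toGraded_actSeries_exp_sub_one {K : Type} [Field K] [CharZero K] [Algebra ℚ K]
    (Y X : CPL K) :
    toGraded (actSeries (PowerSeries.exp K - 1) Y X) =
      (treePreLie K).expMul (toGraded Y) (toGraded X) - toGraded X := by
  rw [toGraded_actSeries, GradedPreLie.expMul_apply,
    filtSum_succ (a := fun n => (n.factorial : K)⁻¹ • _)
      ((treePreLie K).inv_factorial_smul_pow_mem_filt _ _),
    filtSum_succ fun n => Submodule.smul_mem _ _
      ((treePreLie K).rightMul_pow_mem_filt _ (mem_filt_zero _) n)]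
  simp [PowerSeries.coeff_exp, PowerSeries.coeff_one]

theorem toGraded_OmegaQ_equation :
    (treePreLie (RatFunc ℚ)).shiftExp (extendGraded (toGraded Omega)) RatFunc.X
        (toGraded OmegaQ) - toGraded OmegaQ =
      (treePreLie (RatFunc ℚ)).mul (toGraded (cdot (RatFunc ℚ))) (toGraded OmegaQ) +
        (RatFunc.X - 1 : RatFunc ℚ) • toGraded (cdot (RatFunc ℚ)) := by
  have h : toGraded (actSeries (PowerSeries.exp (RatFunc ℚ) - 1) (extendScalars Omega)
      (shift RatFunc.X OmegaQ)) + toGraded (shift RatFunc.X OmegaQ) - toGraded OmegaQ =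
      (treePreLie (RatFunc ℚ)).mul (toGraded (cdot (RatFunc ℚ))) (toGraded OmegaQ) +
        (RatFunc.X - 1 : RatFunc ℚ) • toGraded (cdot (RatFunc ℚ)) :=
    congrArg toGraded isOmegaQ_OmegaQ
  rw [toGraded_actSeries_exp_sub_one, sub_add_cancel] at h
  exact h

theorem gradedDegree_cdot (K : Type) [Field K] :
    gradedDegree K (Component K) (toGraded (cdot K)) = toGraded (cdot K) := by
  funext n
  change (n : K) • toGraded (cdot K) n = _
  by_cases h : n = 1
  · subst h
    rw [Nat.cast_one, one_smul]
  · have h0 : toGraded (cdot K) n = 0 := Pi.single_eq_of_ne h _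
    rw [h0, smul_zero]

theorem toGraded_OmegaQ_eq_sum (n : ℕ) :
    toGraded OmegaQ n = ∑ k ∈ Finset.range n,
      ((RatFunc.X - 1) * (RatFunc.X ^ (k + 1) - 1)⁻¹ : RatFunc ℚ) •
        (treePreLie (RatFunc ℚ)).shiftExpProd (extendGraded (toGraded Omega)) RatFunc.X k
          (toGraded (cdot (RatFunc ℚ))) n :=
  (treePreLie (RatFunc ℚ)).eq_sum_shiftExpProd _ _ RatFunc.X_ne_zero
    (fun k => X_pow_sub_one_ne_zero k.succ_pos) toGraded_cdot_ratFunc_eq_filtSum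
    (gradedDegree_cdot _) toGraded_OmegaQ_equation n

end Extension

-- Polynomiality of the coefficients of the partial products

section Integrality

/-- The polynomials, as a subring of the rational functions. -/
def polynomialSubring : Subring (RatFunc ℚ) := (algebraMap ℚ[X] (RatFunc ℚ)).range

theorem algebraMap_mem_polynomialSubring (c : ℚ) :
    algebraMap ℚ (RatFunc ℚ) c ∈ polynomialSubring :=
  ⟨C c, by rw [IsScalarTower.algebraMap_apply ℚ ℚ[X] (RatFunc ℚ)]; rfl⟩

theorem X_mem_polynomialSubring : (RatFunc.X : RatFunc ℚ) ∈ polynomialSubring :=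
  ⟨X, RatFunc.algebraMap_X⟩

/-- The combinations of trees with polynomial coefficients. -/
def polynomialPL : AddSubgroup (PL (RatFunc ℚ)) where
  carrier := {A | ∀ T, A T ∈ polynomialSubring}
  zero_mem' := fun _ => zero_mem _
  add_mem' := fun hA hB T => add_mem (hA T) (hB T)
  neg_mem' := fun hA T => neg_mem (hA T)

theorem smul_mem_polynomialPL {c : RatFunc ℚ} (hc : c ∈ polynomialSubring) {A : PL (RatFunc ℚ)}
    (hA : A ∈ polynomialPL) : c • A ∈ polynomialPL := fun T => mul_mem hc (hA T)

theorem single_mem_polynomialPL (T : RootedTree) : Finsupp.single T 1 ∈ polynomialPL := fun U => by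
  classical
  rw [Finsupp.single_apply]
  split
  · exact one_mem _
  · exact zero_mem _

theorem preLie_mem_polynomialPL {A B : PL (RatFunc ℚ)} (hA : A ∈ polynomialPL)
    (hB : B ∈ polynomialPL) : preLie (RatFunc ℚ) A B ∈ polynomialPL := by
  rw [preLie, Finsupp.linearCombination_apply, Finsupp.sum, LinearMap.sum_apply]
  refine sum_mem fun T _ => ?_
  rw [LinearMap.smul_apply, Finsupp.linearCombination_apply, Finsupp.sum]
  refine smul_mem_polynomialPL (hA T) (sum_mem fun T' _ => smul_mem_polynomialPL (hB T') ?_)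
  refine multiset_sum_mem _ fun x hx => ?_
  obtain ⟨U, _, rfl⟩ := Multiset.mem_map.mp hx
  exact single_mem_polynomialPL U

theorem extendPL_mem_polynomialPL (A : PL ℚ) : extendPL A ∈ polynomialPL := fun T =>
  algebraMap_mem_polynomialSubring (A T)

/-- The series with polynomial coefficients. -/
def polynomialSeries : AddSubgroup (∀ n, Component (RatFunc ℚ) n) where
  carrier := {A | ∀ n, Component.val n (A n) ∈ polynomialPL}
  zero_mem' := fun n => by rw [Pi.zero_apply, map_zero]; exact zero_mem _
  add_mem' := fun hA hB n => by rw [Pi.add_apply, map_add]; exact add_mem (hA n) (hB n)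
  neg_mem' := fun hA n => by rw [Pi.neg_apply, map_neg]; exact neg_mem (hA n)

theorem rightMul_mem_polynomialSeries {A B : ∀ n, Component (RatFunc ℚ) n}
    (hA : A ∈ polynomialSeries) (hB : B ∈ polynomialSeries) :
    (treePreLie (RatFunc ℚ)).rightMul B A ∈ polynomialSeries := fun n => by
  rw [GradedPreLie.rightMul_apply, val_treePreLie_mul]
  exact sum_mem fun p _ => preLie_mem_polynomialPL (hA p.1) (hB p.2)

theorem rightMul_pow_mem_polynomialSeries {A B : ∀ n, Component (RatFunc ℚ) n}
    (hA : A ∈ polynomialSeries) (hB : B ∈ polynomialSeries) (i : ℕ) :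
    ((treePreLie (RatFunc ℚ)).rightMul B ^ i) A ∈ polynomialSeries := by
  induction i with
  | zero => simpa using hA
  | succ i ih =>
    rw [pow_succ', Module.End.mul_apply]
    exact rightMul_mem_polynomialSeries ih hB

theorem expMul_mem_polynomialSeries {A B : ∀ n, Component (RatFunc ℚ) n}
    (hA : A ∈ polynomialSeries) (hB : B ∈ polynomialSeries) :
    (treePreLie (RatFunc ℚ)).expMul B A ∈ polynomialSeries := fun n => by
  rw [GradedPreLie.expMul_apply]
  simp only [filtSum, map_sum, Pi.smul_apply, map_smul]
  refine sum_mem fun i _ => smul_mem_polynomialPL ?_ (rightMul_pow_mem_polynomialSeries hA hB i n)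
  have h := algebraMap_mem_polynomialSubring (i.factorial : ℚ)⁻¹
  rwa [map_inv₀, map_natCast] at h

/-- The q-shift of a series starting in degree `k` is divisible by q^k, and the action of the
exponential involves only the rational constants 1/i!. -/
theorem inv_pow_smul_shiftExp_mem_polynomialSeries {A B : ∀ n, Component (RatFunc ℚ) n}
    (hA : A ∈ polynomialSeries) (hB : B ∈ polynomialSeries) {k : ℕ}
    (hk : A ∈ filt (RatFunc ℚ) (Component (RatFunc ℚ)) k) :
    ((RatFunc.X : RatFunc ℚ) ^ k)⁻¹ • (treePreLie (RatFunc ℚ)).shiftExp B RatFunc.X A ∈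
      polynomialSeries := by
  rw [GradedPreLie.shiftExp, Module.End.mul_apply,
    ← map_smul ((treePreLie (RatFunc ℚ)).expMul B)]
  suffices h : ((RatFunc.X : RatFunc ℚ) ^ k)⁻¹ • gradedShift (Component (RatFunc ℚ)) RatFunc.X A ∈
      polynomialSeries from expMul_mem_polynomialSeries h hB
  intro n
  rw [Pi.smul_apply, show gradedShift (Component (RatFunc ℚ)) RatFunc.X A n =
    (RatFunc.X : RatFunc ℚ) ^ n • A n from rfl]
  rcases Nat.lt_or_ge n k with h | h
  · rw [hk n h, smul_zero, smul_zero, map_zero]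
    exact zero_mem _
  · obtain ⟨j, rfl⟩ := Nat.exists_eq_add_of_le h
    rw [smul_smul, pow_add, inv_mul_cancel_left₀ (pow_ne_zero _ RatFunc.X_ne_zero), map_smul]
    exact smul_mem_polynomialPL (pow_mem X_mem_polynomialSubring j) (hA _)

theorem shiftExpProd_mem_polynomialSeries {A B : ∀ n, Component (RatFunc ℚ) n}
    (hA : A ∈ polynomialSeries) (hB : B ∈ polynomialSeries) (k : ℕ) :
    (treePreLie (RatFunc ℚ)).shiftExpProd B RatFunc.X k A ∈ polynomialSeries := by
  induction k with
  | zero => exact hA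
  | succ k ih =>
    rw [GradedPreLie.shiftExpProd_succ_apply]
    exact sub_mem ih (inv_pow_smul_shiftExp_mem_polynomialSeries ih hB
      (GradedPreLie.shiftExpProd_mem_filt _ _ _ RatFunc.X_ne_zero A k))

end Integrality

-- Cyclotomic denominators and simple poles

section Denominators

/-- The factor X − 1 is Φ₁, and X^k − 1 is the product of the Φ_d over the divisors d of `k`, all at
most `n`. -/
theorem X_pow_sub_one_dvd_mul_prod_cyclotomic {k n : ℕ} (hk : 0 < k) (hkn : k ≤ n) :
    (X ^ k - 1 : ℚ[X]) ∣ (X - 1) * ∏ d ∈ Finset.Icc 2 n, cyclotomic d ℚ := by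
  have h : (X - 1 : ℚ[X]) * ∏ d ∈ Finset.Icc 2 n, cyclotomic d ℚ =
      ∏ d ∈ Finset.Icc 1 n, cyclotomic d ℚ := by
    rw [← Finset.insert_Icc_add_one_left_eq_Icc (show 1 ≤ n by omega), one_add_one_eq_two,
      Finset.prod_insert (by simp), cyclotomic_one]
  rw [h, ← prod_cyclotomic_eq_X_pow_sub_one hk]
  refine Finset.prod_dvd_prod_of_subset _ _ _ fun d hd => ?_
  exact Finset.mem_Icc.mpr ⟨Nat.pos_of_mem_divisors hd, (Nat.divisor_le hd).trans hkn⟩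

theorem prod_cyclotomic_ne_zero (n : ℕ) : ∏ d ∈ Finset.Icc 2 n, cyclotomic d ℚ ≠ 0 :=
  Finset.prod_ne_zero_iff.mpr fun d _ => cyclotomic_ne_zero d ℚ

theorem denom_OmegaQ_dvd (n : ℕ) (T : RootedTree) :
    ((OmegaQ n : PL (RatFunc ℚ)) T).denom ∣ ∏ d ∈ Finset.Icc 2 n, cyclotomic d ℚ := by
  set p : ℚ[X] := ∏ d ∈ Finset.Icc 2 n, cyclotomic d ℚ with hp
  have hp0 : p ≠ 0 := prod_cyclotomic_ne_zero n
  set B := extendGraded (toGraded Omega) with hB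
  set c : ℕ → RatFunc ℚ := fun k => Component.val n ((treePreLie (RatFunc ℚ)).shiftExpProd B
    RatFunc.X k (toGraded (cdot (RatFunc ℚ))) n) T with hc
  have hdot : toGraded (cdot (RatFunc ℚ)) ∈ polynomialSeries := by
    rw [← extendGraded_cdot]
    exact fun n => extendPL_mem_polynomialPL _
  have hcmem : ∀ k, c k ∈ polynomialSubring := fun k =>
    shiftExpProd_mem_polynomialSeries hdot (fun n => extendPL_mem_polynomialPL _) k n T
  have hsum : (OmegaQ n : PL (RatFunc ℚ)) T = ∑ k ∈ Finset.range n,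
      ((RatFunc.X - 1) * (RatFunc.X ^ (k + 1) - 1)⁻¹ : RatFunc ℚ) * c k := by
    change Component.val n (toGraded OmegaQ n) T = _
    rw [toGraded_OmegaQ_eq_sum, map_sum, Finsupp.finsetSum_apply]
    simp only [map_smul, Finsupp.smul_apply, smul_eq_mul]
    rfl
  -- The numerator q − 1 of each coefficient supplies the Φ₁ missing from `p`, so (q − 1)p absorbs
  -- q^(k+1) − 1.
  have hmem : algebraMap ℚ[X] (RatFunc ℚ) p * (OmegaQ n : PL (RatFunc ℚ)) T ∈
      polynomialSubring := by
    rw [hsum, Finset.mul_sum]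
    refine sum_mem fun k hk => ?_
    obtain ⟨r, hr⟩ := X_pow_sub_one_dvd_mul_prod_cyclotomic k.succ_pos (Finset.mem_range.mp hk)
    have hr' := congrArg (algebraMap ℚ[X] (RatFunc ℚ)) hr
    rw [← hp] at hr'
    simp only [map_mul, map_sub, map_pow, map_one, RatFunc.algebraMap_X] at hr'
    have h0 := X_pow_sub_one_ne_zero k.succ_pos
    rw [← mul_assoc, ← mul_assoc, mul_comm (algebraMap _ _ p), hr', mul_comm (RatFunc.X ^ _ - 1),
      mul_inv_cancel_right₀ h0]
    exact mul_mem ⟨r, rfl⟩ (hcmem k)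
  obtain ⟨r, hr⟩ := hmem
  refine (RatFunc.denom_dvd hp0).mpr ⟨r, ?_⟩
  rw [hr, mul_div_cancel_left₀ _ (RatFunc.algebraMap_ne_zero hp0)]

/-- Distinct cyclotomic polynomials are coprime over ℚ and each is separable; this is what makes the
poles simple. -/
theorem separable_prod_cyclotomic (n : ℕ) :
    (∏ d ∈ Finset.Icc 2 n, cyclotomic d ℚ).Separable := by
  refine separable_prod' (fun _ _ _ _ h => cyclotomic.isCoprime_rat h) fun d hd => ?_
  have : NeZero (d : ℚ) := ⟨by
    have := (Finset.mem_Icc.mp hd).1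
    exact Nat.cast_ne_zero.mpr (by omega)⟩
  exact separable_cyclotomic d ℚ

theorem poleOrder_of_denom_dvd {f : RatFunc ℚ} {n : ℕ}
    (hf : f.denom ∣ ∏ d ∈ Finset.Icc 2 n, cyclotomic d ℚ) {z : ℂ} (hz : poleOrder f z ≠ 0) :
    poleOrder f z = 1 ∧ (∃ m : ℕ, 0 < m ∧ z ^ m = 1) ∧ z ≠ 1 := by
  have hle : poleOrder f z ≤ 1 :=
    rootMultiplicity_le_one_of_separable ((separable_prod_cyclotomic n).of_dvd hf).map z
  refine ⟨by omega, ?_⟩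
  have hroot : (f.denom.map (algebraMap ℚ ℂ)).IsRoot z := by
    by_contra h
    exact hz (rootMultiplicity_eq_zero h)
  have hroot' := hroot.dvd (Polynomial.map_dvd (algebraMap ℚ ℂ) hf)
  rw [Polynomial.map_prod, IsRoot.def, eval_prod, Finset.prod_eq_zero_iff] at hroot'
  obtain ⟨d, hd, hdz⟩ := hroot'
  have hd2 := (Finset.mem_Icc.mp hd).1
  have : NeZero (d : ℂ) := ⟨Nat.cast_ne_zero.mpr (by omega)⟩
  rw [map_cyclotomic] at hdz
  have hprim := isRoot_cyclotomic_iff.mp hdz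
  refine ⟨⟨d, by omega, hprim.pow_eq_one⟩, ?_⟩
  rintro rfl
  have := hprim.eq_orderOf
  rw [orderOf_one] at this
  omega

end Denominators
end

end RootedTrees

theorem mainTheorem5 :
    (∀ n : ℕ, RootedTrees.commonDenominator (RootedTrees.OmegaQ n) ∣
      ∏ d ∈ Finset.Icc 2 n, Polynomial.cyclotomic d ℚ) ∧
    (∀ (n : ℕ) (T : RootedTrees.RootedTree) (z : ℂ),
      RootedTrees.poleOrder ((RootedTrees.OmegaQ n : RootedTrees.PL (RatFunc ℚ)) T) z ≠ 0 →
        RootedTrees.poleOrder ((RootedTrees.OmegaQ n : RootedTrees.PL (RatFunc ℚ)) T) z = 1 ∧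
        (∃ m : ℕ, 0 < m ∧ z ^ m = 1) ∧ z ≠ 1) :=
  ⟨fun n => (RootedTrees.commonDenominator_dvd_iff _ (RootedTrees.prod_cyclotomic_ne_zero n)).mpr
    (RootedTrees.denom_OmegaQ_dvd n),
  fun n T _ hz => RootedTrees.poleOrder_of_denom_dvd (RootedTrees.denom_OmegaQ_dvd n T) hz⟩
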